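/- **Setting.** Let $n,d,\tau\ge 1$ and consider $f(x)=\frac1n\sum_{i=1}^n f_i(x)$ on $\mathbb R^d$ with $f_i(x)=\mathbb E_{\xi_i\sim\mathbb P_i}[F_i(x;\xi_i)]$, where each $F_i(\cdot;s)$ is differentiable. Assume that every $f_i$ is continuously differentiable with $L$-Lipschitz gradient ($L>0$), and that $f$ is bounded below, with $f^\ast=\inf f$. Let $W^{(0)},\dots,W^{(\tau-1)}\in\mathbb R^{n\times n}$ be doubly stochastic matrices with $W^{(\tau-1)}\cdots W^{(1)}W^{(0)}=\frac1n\mathbf 1\mathbf 1^{\mathsf T}$. Gradient tracking with stepsize $\alpha>0$ starts from (possibly random) $x_i^{(0)}\in\mathbb R^d$ and $g_i^{(0)}=\nabla F_i(x_i^{(0)};\xi_i^{(0)})$ and iterates, for $k\ge 0$ and with $w^{(k)}_{ij}$ the entries of $W^{(k\bmod\tau)}$, $$x_i^{(k+1)}=\sum_{j} w^{(k)}_{ij}\,(x_j^{(k)}-\alpha g_j^{(k)}),\qquad g_i^{(k+1)}=\sum_j w^{(k)}_{ij}\,g_j^{(k)}+\nabla F_i(x_i^{(k+1)};\xi_i^{(k+1)})-\nabla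 F_i(x_i^{(k)};\xi_i^{(k)}).$$ The samples $\xi_i^{(k)}\sim\mathbb P_i$ ($k\ge0$, $1\le i\le n$) are mutually independent and independent of the initial points. With $\mathcal F^{(k)}$ the $\sigma$-algebra generated by $x^{(0)},\dots,x^{(k)}$, where $x^{(k)}=(x_1^{(k)},\dots,x_n^{(k)})$, and some $\sigma>0$, the stochastic gradients satisfy, for all $k$ and $i$, $$\mathbb E[\nabla F_i(x_i^{(k)};\xi_i^{(k)})\mid\mathcal F^{(k)}]=\nabla f_i(x_i^{(k)}),\qquad \mathbb E[\|\nabla F_i(x_i^{(k)};\xi_i^{(k)})-\nabla f_i(x_i^{(k)})\|^2\mid\mathcal F^{(k)}]\le\sigma^2 .$$ Write $\bar x^{(k)}=\frac1n\sum_i x_i^{(k)}$ and $\overline{\nabla f}(x^{(k)})=\frac1n\sum_i\nabla f_i(x_i^{(k)})$. **Corollary.** For all $\ell>0$ and $B\in\mathbb R$ there are constants $\gamma_4,\gamma_5,\gamma_6>0$, depending only on $\ell$ and $B$, such that the following holds in every setting as above with $L\ge\ell$ whose initial data satisfy $$\mathbb E f(\bar x^{(0)})-f^\ast\le B,\qquad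 \frac1n\sum_i\mathbb E\|x_i^{(0)}-\bar x^{(0)}\|^2\le B,\qquad \frac1{nL^2}\sum_i\mathbb E\big\|\nabla f_i(x_i^{(0)})-\overline{\nabla f}(x^{(0)})\big\|^2\le B$$ (all these expectations being finite). Let $T\ge\tau$ be an integer and let the algorithm be run, without warm-up, with $$\alpha=\min\Big\{\Big(\frac{c_0}{c_1T}\Big)^{1/2},\Big(\frac{c_0}{c_2T}\Big)^{1/3},\frac1{2L},\frac1{4\sqrt3\,\tau^2L}\Big\},\qquad c_0=L^2,\quad c_1=\frac{L\sigma^2}{n},\quad c_2=\tau^3L^2\sigma^2 .$$ Then the expectations below are finite and $$\frac1{T+1}\sum_{k=0}^{T}\Big(\mathbb E\big\|\overline{\nabla f}(x^{(k)})\big\|^2+\mathbb E\big\|\nabla f(\bar x^{(k)})\big\|^2\Big)\le\frac{\gamma_4\tau^2L^3}{T}+\frac{\gamma_5\,\tau L^2\sigma^{2/3}}{T^{2/3}}+\gamma_6\Big(\frac{L^3\sigma^2}{nT}\Big)^{1/2}.$$ -/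

import Mathlib

open MeasureTheory ProbabilityTheory

namespace GTFT

noncomputable section

/-- The parameter space `ℝ^d` with its Euclidean norm. -/
abbrev Vec (d : ℕ) : Type := EuclideanSpace ℝ (Fin d)

/-! ### Mixing matrices -/

/-- `orderedProd W k = W (k-1) * ⋯ * W 1 * W 0`. -/
def orderedProd {n : ℕ} (W : ℕ → Matrix (Fin n) (Fin n) ℝ) : ℕ → Matrix (Fin n) (Fin n) ℝ
  | 0 => 1
  | k + 1 => W k * orderedProd W k

/-- Finite-time consensus with parameter `τ ≥ 1`: the matrices `W 0, …, W (τ-1)` are doubly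
stochastic and `W (τ-1) ⋯ W 1 W 0 = (1/n) 𝟙 𝟙ᵀ`. The values `W l` with `l ≥ τ` play no role. -/
structure FiniteTimeConsensus {n : ℕ} (τ : ℕ) (W : ℕ → Matrix (Fin n) (Fin n) ℝ) : Prop where
  one_le : 1 ≤ τ
  doublyStochastic : ∀ l, l < τ → W l ∈ doublyStochastic ℝ (Fin n)
  exact_averaging : orderedProd W τ = Matrix.of fun _ _ => (1 : ℝ) / n

/-! ### The optimization problem -/

/-- The average `(1/n) ∑ i, v i` of `n` vectors. -/
def avg {n d : ℕ} (v : Fin n → Vec d) : Vec d := (1 / (n : ℝ)) • ∑ i, v i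

section Problem

variable {n d : ℕ} {Ξ : Fin n → Type*} [∀ i, MeasurableSpace (Ξ i)]

/-- The local objective `f_i(x) = 𝔼_{s ∼ P i} [F_i(x; s)]`. -/
def localObj (F : ∀ i, Vec d → Ξ i → ℝ) (P : ∀ i, Measure (Ξ i)) (i : Fin n) (x : Vec d) : ℝ :=
  ∫ s, F i x s ∂(P i)

/-- The objective `f(x) = (1/n) ∑ i, f_i(x)`. -/
def objective (F : ∀ i, Vec d → Ξ i → ℝ) (P : ∀ i, Measure (Ξ i)) (x : Vec d) : ℝ :=
  (1 / (n : ℝ)) * ∑ i, localObj F P i x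

/-- The stochastic gradient `∇F_i(x; s)`, the gradient of `F_i(·; s)` at `x`. -/
def stochGrad (F : ∀ i, Vec d → Ξ i → ℝ) (i : Fin n) (x : Vec d) (s : Ξ i) : Vec d :=
  gradient (fun y => F i y s) x

/-- The average of the local gradients at the agents' own points, `(1/n) ∑ i, ∇f_i(x_i)`. -/
def avgGrad (F : ∀ i, Vec d → Ξ i → ℝ) (P : ∀ i, Measure (Ξ i)) (x : Fin n → Vec d) : Vec d :=
  avg fun i => gradient (localObj F P i) (x i)

/-- The losses `F_i` are such that `f_i` and `∇F_i` are well defined. -/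
structure WellPosed (F : ∀ i, Vec d → Ξ i → ℝ) (P : ∀ i, Measure (Ξ i)) : Prop where
  integrable : ∀ i x, Integrable (F i x) (P i)
  differentiable : ∀ i s, Differentiable ℝ fun x => F i x s
  measurable_grad : ∀ i, Measurable fun p : Vec d × Ξ i => stochGrad F i p.1 p.2

/-- Smoothness: every `f_i` is continuously differentiable with `L`-Lipschitz gradient, `L > 0`,
and `f` is bounded below. -/
structure Smooth (F : ∀ i, Vec d → Ξ i → ℝ) (P : ∀ i, Measure (Ξ i)) (L : ℝ) : Prop where
  pos : 0 < L
  contDiff : ∀ i, ContDiff ℝ 1 (localObj F P i)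
  lipschitz : ∀ i x y,
    ‖gradient (localObj F P i) x - gradient (localObj F P i) y‖ ≤ L * ‖x - y‖
  bddBelow : BddBelow (Set.range (objective F P))

/-- The optimal value `f^* = inf f`. -/
def optValue (F : ∀ i, Vec d → Ξ i → ℝ) (P : ∀ i, Measure (Ξ i)) : ℝ :=
  ⨅ x, objective F P x

/-! ### The algorithm -/

/-- The pair `(x^(k), g^(k))` of parameters and tracking variables after `k` iterations of gradient
tracking with the matrices `W 0, …, W (τ-1)` used cyclically, stepsize `α`, initial parameters `x₀`,
and sample `ξ k i` drawn by agent `i` at iteration `k`. -/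
def iter (F : ∀ i, Vec d → Ξ i → ℝ) (τ : ℕ) (W : ℕ → Matrix (Fin n) (Fin n) ℝ) (α : ℝ)
    (x₀ : Fin n → Vec d) (ξ : ℕ → ∀ i, Ξ i) : ℕ → (Fin n → Vec d) × (Fin n → Vec d)
  | 0 => (x₀, fun i => stochGrad F i (x₀ i) (ξ 0 i))
  | k + 1 =>
    let x := (iter F τ W α x₀ ξ k).1
    let g := (iter F τ W α x₀ ξ k).2
    let x' : Fin n → Vec d := fun i => ∑ j, W (k % τ) i j • (x j - α • g j)
    (x', fun i => ∑ j, W (k % τ) i j • g j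
      + stochGrad F i (x' i) (ξ (k + 1) i) - stochGrad F i (x i) (ξ k i))

variable {Ω : Type*}

/-- The random parameters `x^(k)` of all agents, for random initial parameters `x₀` and samples
`ξ`. -/
def params (F : ∀ i, Vec d → Ξ i → ℝ) (τ : ℕ) (W : ℕ → Matrix (Fin n) (Fin n) ℝ) (α : ℝ)
    (x₀ : Ω → Fin n → Vec d) (ξ : ℕ → ∀ i, Ω → Ξ i) (k : ℕ) (ω : Ω) : Fin n → Vec d :=
  (iter F τ W α (x₀ ω) (fun k i => ξ k i ω) k).1

/-- The σ-algebra `ℱ^(k)` generated by the random vectors `x^(0), …, x^(k)`. -/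
@[reducible] def history (X : ℕ → Ω → Fin n → Vec d) (k : ℕ) : MeasurableSpace Ω :=
  ⨆ j ∈ Set.Iic k, MeasurableSpace.comap (X j) inferInstance

/-- The samples: `ξ k i` has law `P i`, all the `ξ k i` are mutually independent, and they are
independent of the initial parameters. -/
structure Sampling [MeasurableSpace Ω] (μ : Measure Ω) (P : ∀ i, Measure (Ξ i))
    (x₀ : Ω → Fin n → Vec d) (ξ : ℕ → ∀ i, Ω → Ξ i) : Prop where
  measurable_init : Measurable x₀
  measurable : ∀ k i, Measurable (ξ k i)
  law : ∀ k i, μ.map (ξ k i) = P i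
  indep : iIndepFun (fun (p : ℕ × Fin n) => ξ p.1 p.2) μ
  indep_init : IndepFun x₀ (fun ω (p : ℕ × Fin n) => ξ p.1 p.2 ω) μ

/-- The stochastic gradients evaluated along the random points `X k` with samples `ξ k` are
conditionally unbiased given `ℱ^(k)`, with conditional variance at most `σ^2`, `σ > 0`. -/
structure GradientNoise [MeasurableSpace Ω] (μ : Measure Ω) (F : ∀ i, Vec d → Ξ i → ℝ)
    (P : ∀ i, Measure (Ξ i)) (σ : ℝ) (X : ℕ → Ω → Fin n → Vec d) (ξ : ℕ → ∀ i, Ω → Ξ i) :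
    Prop where
  pos : 0 < σ
  integrable : ∀ k i, Integrable (fun ω => stochGrad F i (X k ω i) (ξ k i ω)) μ
  unbiased : ∀ k i,
    μ[fun ω => stochGrad F i (X k ω i) (ξ k i ω) | history X k]
      =ᵐ[μ] fun ω => gradient (localObj F P i) (X k ω i)
  sq_integrable : ∀ k i, Integrable (fun ω =>
    ‖stochGrad F i (X k ω i) (ξ k i ω) - gradient (localObj F P i) (X k ω i)‖ ^ 2) μ
  variance_le : ∀ k i,
    μ[fun ω => ‖stochGrad F i (X k ω i) (ξ k i ω) - gradient (localObj F P i) (X k ω i)‖ ^ 2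
      | history X k] ≤ᵐ[μ] fun _ => σ ^ 2

/-- `B` bounds the initial data: the initial suboptimality `𝔼 f(x̄^(0)) - f^*`, the initial consensus
error `(1/n) ∑ i, 𝔼 ‖x_i^(0) - x̄^(0)‖²`, and the initial gradient heterogeneity in units of `L²`,
`(1/n) ∑ i, 𝔼 ‖∇f_i(x_i^(0)) - (1/n) ∑ j, ∇f_j(x_j^(0))‖² / L²` (all expectations being finite). -/
structure InitialDataBound [MeasurableSpace Ω] (μ : Measure Ω) (F : ∀ i, Vec d → Ξ i → ℝ)
    (P : ∀ i, Measure (Ξ i)) (L B : ℝ) (x₀ : Ω → Fin n → Vec d) : Prop where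
  integrable_obj : Integrable (fun ω => objective F P (avg (x₀ ω))) μ
  integrable_consensus : ∀ i, Integrable (fun ω => ‖x₀ ω i - avg (x₀ ω)‖ ^ 2) μ
  integrable_heterogeneity : ∀ i, Integrable (fun ω =>
    ‖gradient (localObj F P i) (x₀ ω i) - avgGrad F P (x₀ ω)‖ ^ 2) μ
  suboptimality : (∫ ω, objective F P (avg (x₀ ω)) ∂μ) - optValue F P ≤ B
  consensus : (1 / (n : ℝ)) * ∑ i, ∫ ω, ‖x₀ ω i - avg (x₀ ω)‖ ^ 2 ∂μ ≤ B
  heterogeneity : (1 / (n : ℝ)) * ∑ i, ∫ ω,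
    ‖gradient (localObj F P i) (x₀ ω i) - avgGrad F P (x₀ ω)‖ ^ 2 ∂μ ≤ B * L ^ 2

end Problem

/-- The tuned stepsize
`min {(c₀/(c₁T))^(1/2), (c₀/(c₂T))^(1/3), 1/(2L), 1/(4√3 τ²L)}` with
`c₀ = L²`, `c₁ = Lσ²/n`, `c₂ = τ³L²σ²`. -/
def tunedStep (n τ : ℕ) (L σ : ℝ) (T : ℕ) : ℝ :=
  let c₀ : ℝ := L ^ 2
  let c₁ : ℝ := L * σ ^ 2 / n
  let c₂ : ℝ := (τ : ℝ) ^ 3 * L ^ 2 * σ ^ 2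
  min (min ((c₀ / (c₁ * T)) ^ (1 / 2 : ℝ)) ((c₀ / (c₂ * T)) ^ (1 / 3 : ℝ)))
    (min (1 / (2 * L)) (1 / (4 * Real.sqrt 3 * (τ : ℝ) ^ 2 * L)))

end

end GTFT

namespace GTFT

/-! Stack the vectors of all agents and split them orthogonally into average (`consensus`, `J`) and
deviation (`deviation`, `Q`). Mixing preserves averages, so the average tracker always equals the
average stochastic gradient, and the average parameter performs inexact stochastic gradient descent
on `f`. The descent lemma (`Smooth.objective_step_le`) bounds the summed squared gradients by
initial suboptimality over `α`, a variance term `L α σ² / n` per step, and `L²` times the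
accumulated deviation.

The heart is the deviation (`sum_deviation_sq_le`). Unrolling both recursions gives `Q x_k` as a
transient minus `α ∑_{p<k} (k-p) Φ(k,p) (G_p - G_{p-1})`, where `G` is the stochastic gradient,
`G_{-1} = 0`, and `Φ = transition` never increases norms. Since `Φ(k,p) = 0` once `k ≥ p + 2τ` (a
complete cycle has intervened), only a window of length `2τ` matters. Exact gradients and noise are
treated differently. For the former, weighted Cauchy-Schwarz gives a factor `τ⁴`, the Lipschitz
bound returns to deviations and average steps, and `48 α² τ⁴ L² ≤ 1` absorbs the deviations. The
noise is summed by parts; each sample then enters with gain at most `4τ`, and orthogonality over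
time gives `2τ · 16τ² · nσ²`, hence `τ³` instead of `τ⁴`.

Orthogonality needs care: the noise is centred given the past parameters, which need not determine
past noises or the other agents' noise. Independence of the samples closes this gap
(`integral_inner_eq_zero_of_indep`): the noise is centred for almost every fixed value of the
parameter, hence orthogonal to anything built from the other samples.

The tuned stepsize finally balances the `1/α` term against the two noise terms (`tunedStep_spec`).
-/

theorem norm_sub_sub_sq_le {E : Type*} [SeminormedAddCommGroup E] (a b c : E) :
    ‖a - b - c‖ ^ 2 ≤ 2 * ‖b‖ ^ 2 + 4 * ‖a‖ ^ 2 + 4 * ‖c‖ ^ 2 := by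
  have h : ‖a - b - c‖ ≤ ‖a‖ + ‖b‖ + ‖c‖ :=
    (norm_sub_le _ _).trans (add_le_add_left (norm_sub_le _ _) _)
  calc _ ≤ (‖a‖ + ‖b‖ + ‖c‖) ^ 2 := pow_le_pow_left₀ (norm_nonneg _) h 2
    _ ≤ _ := by
      nlinarith [sq_nonneg (‖b‖ - (‖a‖ + ‖c‖)), sq_nonneg (‖a‖ - ‖c‖)]

theorem norm_sub_sq_le_two {E : Type*} [SeminormedAddCommGroup E] (a b : E) :
    ‖a - b‖ ^ 2 ≤ 2 * ‖a‖ ^ 2 + 2 * ‖b‖ ^ 2 := by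
  calc _ ≤ (‖a‖ + ‖b‖) ^ 2 := pow_le_pow_left₀ (norm_nonneg _) (norm_sub_le _ _) 2
    _ ≤ _ := by nlinarith [sq_nonneg (‖a‖ - ‖b‖)]

/-! ### Abstract deviation recursion under norm-nonincreasing mixing -/

section Consensus

variable {E : Type*} [NormedAddCommGroup E] [NormedSpace ℝ E]

/-- The transition operator `A (k-1) ∘ ⋯ ∘ A p ∘ Q` from time `p` to time `k`. -/
noncomputable def transition (A : ℕ → E →ₗ[ℝ] E) (Q : E →ₗ[ℝ] E) : ℕ → ℕ → E →ₗ[ℝ] E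
  | 0, _ => Q
  | k + 1, p => if p ≤ k then A k ∘ₗ transition A Q k p else Q

/-- The increments of a sequence that is extended by `0` to negative times. -/
def increment (G : ℕ → E) : ℕ → E
  | 0 => G 0
  | p + 1 => G (p + 1) - G p

/-- The influence at time `k` of a perturbation of the gradients at time `p`. -/
noncomputable def noiseGain (A : ℕ → E →ₗ[ℝ] E) (Q : E →ₗ[ℝ] E) (k p : ℕ) : E →ₗ[ℝ] E :=
  ((k : ℝ) - p) • transition A Q k p - ((k : ℝ) - (p + 1 : ℕ)) • transition A Q k (p + 1)

variable {A : ℕ → E →ₗ[ℝ] E} {Q : E →ₗ[ℝ] E}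

/-- At `k = p` this is the empty product. For `k < p` it is a default value, which keeps the norm
bound below free of index conditions. -/
theorem transition_of_le {k p : ℕ} (h : k ≤ p) : transition A Q k p = Q := by
  cases k with
  | zero => rfl
  | succ k => rw [transition, if_neg (by omega)]

theorem transition_succ {k p : ℕ} (h : p ≤ k) :
    transition A Q (k + 1) p = A k ∘ₗ transition A Q k p := by
  rw [transition, if_pos h]

theorem norm_transition_le (hA : ∀ k v, ‖A k v‖ ≤ ‖v‖) (k p : ℕ) (v : E) :
    ‖transition A Q k p v‖ ≤ ‖Q v‖ := by
  induction k with
  | zero => exact le_rfl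
  | succ k ih =>
    rw [transition]
    split_ifs
    · exact (hA _ _).trans ih
    · exact le_rfl

theorem transition_eq_zero_of_le {k k' p : ℕ} (hp : p ≤ k) (hk : k ≤ k')
    (h : transition A Q k p = 0) : transition A Q k' p = 0 := by
  induction k', hk using Nat.le_induction with
  | base => exact h
  | succ m hm ih => rw [transition_succ (hp.trans hm), ih, LinearMap.comp_zero]

/-- `Q` commutes with mixing, so the recursion closes on deviations. With gradients extended by
zero, the initial condition is one more increment. -/
theorem deviation_tracker {g G : ℕ → E} (hQA : ∀ k v, Q (A k v) = A k (Q v))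
    (hg₀ : g 0 = G 0) (hg : ∀ k, g (k + 1) = A k (g k) + G (k + 1) - G k) (k : ℕ) :
    Q (g k) = ∑ p ∈ Finset.range (k + 1), transition A Q k p (increment G p) := by
  induction k with
  | zero => simp [transition, increment, hg₀]
  | succ k ih =>
    rw [Finset.sum_range_succ, transition_of_le le_rfl, hg, add_sub_assoc, map_add, hQA, ih,
      map_sum]
    congr 1
    refine Finset.sum_congr rfl fun p hp => ?_
    rw [transition_succ (Nat.lt_succ_iff.1 (Finset.mem_range.1 hp)), LinearMap.comp_apply]

theorem deviation_param {x g G : ℕ → E} {α : ℝ} (hQA : ∀ k v, Q (A k v) = A k (Q v))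
    (hg₀ : g 0 = G 0) (hg : ∀ k, g (k + 1) = A k (g k) + G (k + 1) - G k)
    (hx : ∀ k, x (k + 1) = A k (x k - α • g k)) (k : ℕ) :
    Q (x k) = transition A Q k 0 (x 0)
      - α • ∑ p ∈ Finset.range k, (((k : ℝ) - p) • transition A Q k p) (increment G p) := by
  induction k with
  | zero => simp [transition]
  | succ k ih =>
    -- Raising the weight from `k - p` to `k + 1 - p` adds one copy of each transported increment;
    -- together these copies are the tracker deviation at time `k`.
    have h1 : ∀ p ∈ Finset.range (k + 1),
        (((k + 1 : ℕ) : ℝ) - p) • transition A Q (k + 1) p (increment G p)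
          = A k (((k : ℝ) - p) • transition A Q k p (increment G p))
            + A k (transition A Q k p (increment G p)) := by
      intro p hp
      rw [transition_succ (Nat.lt_succ_iff.1 (Finset.mem_range.1 hp)), LinearMap.comp_apply,
        map_smul]
      push_cast
      module
    simp only [LinearMap.smul_apply] at ih ⊢
    rw [Finset.sum_congr rfl h1, Finset.sum_add_distrib, ← map_sum, ← map_sum,
      ← deviation_tracker hQA hg₀ hg, Finset.sum_range_succ, hx, hQA, map_sub, map_smul, ih,
      transition_succ (Nat.zero_le k), LinearMap.comp_apply]
    simp only [sub_self, zero_smul, add_zero, map_sub, map_smul, smul_add]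
    module

/-- Summation by parts. -/
theorem sum_apply_increment (c : ℕ → E →ₗ[ℝ] E) (s : ℕ → E) (m : ℕ) :
    ∑ p ∈ Finset.range (m + 1), c p (increment s p)
      = ∑ p ∈ Finset.range m, (c p - c (p + 1)) (s p) + c m (s m) := by
  induction m with
  | zero => simp [increment]
  | succ m ih =>
    rw [Finset.sum_range_succ, ih, Finset.sum_range_succ, increment, map_sub, LinearMap.sub_apply]
    abel

/-- The boundary term fits the same formula: for `p = k - 1` the second coefficient in `noiseGain`
is zero. -/
theorem sum_apply_increment_eq_noiseGain (s : ℕ → E) (k : ℕ) :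
    ∑ p ∈ Finset.range k, (((k : ℝ) - p) • transition A Q k p) (increment s p)
      = ∑ p ∈ Finset.range k, noiseGain A Q k p (s p) := by
  cases k with
  | zero => simp
  | succ m =>
    rw [sum_apply_increment (fun p => (((m + 1 : ℕ) : ℝ) - p) • transition A Q (m + 1) p),
      Finset.sum_range_succ _ m]
    simp [noiseGain]

theorem norm_noiseGain_le (hA : ∀ k v, ‖A k v‖ ≤ ‖v‖) (hQ : ∀ v, ‖Q v‖ ≤ ‖v‖) {τ : ℕ}
    {k p : ℕ} (hp : p < k) (hk : k ≤ p + 2 * τ) (v : E) :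
    ‖noiseGain A Q k p v‖ ≤ 4 * τ * ‖v‖ := by
  have hp' : ((p + 1 : ℕ) : ℝ) ≤ k := by exact_mod_cast hp
  have hk' : (k : ℝ) ≤ p + 2 * τ := by exact_mod_cast hk
  have h1 := (norm_transition_le (Q := Q) hA k p v).trans (hQ v)
  have h2 := (norm_transition_le (Q := Q) hA k (p + 1) v).trans (hQ v)
  rw [noiseGain, LinearMap.sub_apply, LinearMap.smul_apply, LinearMap.smul_apply]
  refine (norm_sub_le _ _).trans ?_
  have hp2 : (p : ℝ) ≤ k := by exact_mod_cast hp.le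
  rw [norm_smul, norm_smul, Real.norm_of_nonneg (by linarith), Real.norm_of_nonneg]
  · push_cast at hp' ⊢
    have := norm_nonneg v
    calc _ ≤ ((k : ℝ) - p) * ‖v‖ + ((k : ℝ) - (p + 1)) * ‖v‖ :=
          add_le_add (mul_le_mul_of_nonneg_left h1 (by linarith))
            (mul_le_mul_of_nonneg_left h2 (by linarith))
      _ ≤ _ := by nlinarith
  · push_cast at hp' ⊢; linarith

/-- The inequality is strict because the transition from `p + 1` has to vanish as well. -/
theorem noiseGain_eq_zero {τ : ℕ} (hvan : ∀ k p, p + 2 * τ ≤ k → transition A Q k p = 0)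
    {k p : ℕ} (hk : p + 2 * τ < k) : noiseGain A Q k p = 0 := by
  rw [noiseGain, hvan k p hk.le, hvan k (p + 1) (by omega)]
  simp

/-- The identity on `[0, m)`, extended by `0`. -/
def cutoff (m j : ℕ) : ℝ := if j < m then j else 0

theorem cutoff_nonneg (m j : ℕ) : 0 ≤ cutoff m j := by
  rw [cutoff]; split_ifs <;> positivity

theorem sum_cutoff_le (τ M : ℕ) :
    ∑ j ∈ Finset.range M, cutoff (2 * τ) j ≤ 2 * (τ : ℝ) ^ 2 := by
  have h1 : ∑ j ∈ Finset.range M, cutoff (2 * τ) j ≤ ∑ j ∈ Finset.range (2 * τ), (j : ℝ) := by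
    simp only [cutoff]
    rw [← Finset.sum_filter]
    refine Finset.sum_le_sum_of_subset_of_nonneg (fun j hj => ?_) fun _ _ _ => by positivity
    simp only [Finset.mem_filter] at hj
    exact Finset.mem_range.2 hj.2
  have h2 : (∑ j ∈ Finset.range (2 * τ), (j : ℝ)) * 2 ≤ 2 * (τ : ℝ) ^ 2 * 2 := by
    have := Finset.sum_range_id_mul_two (2 * τ)
    have h3 : (∑ j ∈ Finset.range (2 * τ), j) * 2 ≤ 2 * τ ^ 2 * 2 := by
      rw [this]
      calc 2 * τ * (2 * τ - 1) ≤ 2 * τ * (2 * τ) := Nat.mul_le_mul_left _ (Nat.sub_le _ _)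
        _ = _ := by ring
    have h4 : (((∑ j ∈ Finset.range (2 * τ), j) * 2 : ℕ) : ℝ) ≤ (2 * τ ^ 2 * 2 : ℕ) := by
      exact_mod_cast h3
    push_cast at h4
    exact h4
  linarith

/-- Truncated subtraction is harmless: for `k ≤ a` the argument is `0`, where `cutoff` vanishes. -/
theorem sum_cutoff_sub_le (τ N a : ℕ) :
    ∑ k ∈ Finset.range N, cutoff (2 * τ) (k - a) ≤ 2 * (τ : ℝ) ^ 2 := by
  have h0 : cutoff (2 * τ) 0 = 0 := by simp [cutoff]
  calc ∑ k ∈ Finset.range N, cutoff (2 * τ) (k - a)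
      ≤ ∑ k ∈ Finset.range (a + N), cutoff (2 * τ) (k - a) :=
        Finset.sum_le_sum_of_subset_of_nonneg (Finset.range_mono (by omega))
          fun _ _ _ => cutoff_nonneg _ _
    _ = ∑ k ∈ Finset.range N, cutoff (2 * τ) k := by
        rw [Finset.sum_range_add, Finset.sum_eq_zero, zero_add]
        · simp
        · intro k hk
          rw [Nat.sub_eq_zero_of_le (Finset.mem_range.1 hk).le, h0]
    _ ≤ _ := sum_cutoff_le τ N

theorem sum_cutoff_sub_succ_le (τ N k : ℕ) :
    ∑ q ∈ Finset.range N, cutoff (2 * τ) (k - (q + 1)) ≤ 2 * (τ : ℝ) ^ 2 := by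
  have h0 : cutoff (2 * τ) 0 = 0 := by simp [cutoff]
  calc ∑ q ∈ Finset.range N, cutoff (2 * τ) (k - (q + 1))
      ≤ ∑ q ∈ Finset.range (k + N), cutoff (2 * τ) (k - (q + 1)) :=
        Finset.sum_le_sum_of_subset_of_nonneg (Finset.range_mono (by omega))
          fun _ _ _ => cutoff_nonneg _ _
    _ = ∑ q ∈ Finset.range k, cutoff (2 * τ) q := by
        rw [Finset.sum_range_add, Finset.sum_eq_zero (s := Finset.range N), add_zero,
          ← Finset.sum_range_reflect]
        · refine Finset.sum_congr rfl fun q hq => ?_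
          congr 1; have := Finset.mem_range.1 hq; omega
        · intro q _
          rw [Nat.sub_eq_zero_of_le (by omega), h0]
    _ ≤ _ := sum_cutoff_le τ k

/-- The part of the deviation that is driven by the changes of the exact gradients. -/
noncomputable def drift (A : ℕ → E →ₗ[ℝ] E) (Q : E →ₗ[ℝ] E) (H : ℕ → E) (k : ℕ) : E :=
  ∑ q ∈ Finset.range (k - 1),
    (((k : ℝ) - (q + 1 : ℕ)) • transition A Q k (q + 1)) (H (q + 1) - H q)

/-- Cauchy-Schwarz weighted by the elapsed times themselves, which may be cut off at `2 * τ` since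
later transitions vanish. One factor of the weight stays inside, to be summed over `k` afterwards.
-/
theorem norm_drift_sq_le (hA : ∀ k v, ‖A k v‖ ≤ ‖v‖) (hQ : ∀ v, ‖Q v‖ ≤ ‖v‖) {τ : ℕ}
    (hvan : ∀ k p, p + 2 * τ ≤ k → transition A Q k p = 0) (H : ℕ → E) {k T : ℕ} (hk : k ≤ T) :
    ‖drift A Q H k‖ ^ 2 ≤ 2 * (τ : ℝ) ^ 2 *
      ∑ q ∈ Finset.range T, cutoff (2 * τ) (k - (q + 1)) * ‖H (q + 1) - H q‖ ^ 2 := by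
  have h1 : ‖drift A Q H k‖
      ≤ ∑ q ∈ Finset.range T, cutoff (2 * τ) (k - (q + 1)) * ‖H (q + 1) - H q‖ := by
    refine (norm_sum_le _ _).trans ?_
    refine le_trans (Finset.sum_le_sum (g := fun q =>
      cutoff (2 * τ) (k - (q + 1)) * ‖H (q + 1) - H q‖) fun q hq => ?_)
      (Finset.sum_le_sum_of_subset_of_nonneg (Finset.range_mono (by omega))
        fun _ _ _ => mul_nonneg (cutoff_nonneg _ _) (norm_nonneg _))
    have hq' : q + 1 ≤ k := by have := Finset.mem_range.1 hq; omega
    rw [LinearMap.smul_apply, norm_smul, ← Nat.cast_sub hq', Real.norm_of_nonneg (by positivity),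
      cutoff]
    split_ifs with h
    · gcongr
      exact (norm_transition_le hA _ _ _).trans (hQ _)
    · rw [hvan k (q + 1) (by omega)]; simp
  have h2 : (∑ q ∈ Finset.range T, cutoff (2 * τ) (k - (q + 1)) * ‖H (q + 1) - H q‖) ^ 2
      ≤ (∑ q ∈ Finset.range T, cutoff (2 * τ) (k - (q + 1))) *
        ∑ q ∈ Finset.range T, cutoff (2 * τ) (k - (q + 1)) * ‖H (q + 1) - H q‖ ^ 2 :=
    Finset.sum_sq_le_sum_mul_sum_of_sq_le_mul _ (fun _ _ => cutoff_nonneg _ _)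
      (fun _ _ => mul_nonneg (cutoff_nonneg _ _) (sq_nonneg _)) fun _ _ => by ring_nf; rfl
  calc _ ≤ _ := pow_le_pow_left₀ (norm_nonneg _) h1 2
    _ ≤ _ := h2
    _ ≤ _ := by
      gcongr
      · exact Finset.sum_nonneg fun _ _ => mul_nonneg (cutoff_nonneg _ _) (sq_nonneg _)
      · exact sum_cutoff_sub_succ_le τ T k

theorem sum_norm_drift_sq_le (hA : ∀ k v, ‖A k v‖ ≤ ‖v‖) (hQ : ∀ v, ‖Q v‖ ≤ ‖v‖) {τ : ℕ}
    (hvan : ∀ k p, p + 2 * τ ≤ k → transition A Q k p = 0) (H : ℕ → E) (T : ℕ) :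
    ∑ k ∈ Finset.range (T + 1), ‖drift A Q H k‖ ^ 2
      ≤ 4 * (τ : ℝ) ^ 4 * ∑ q ∈ Finset.range T, ‖H (q + 1) - H q‖ ^ 2 := by
  calc _ ≤ ∑ k ∈ Finset.range (T + 1), 2 * (τ : ℝ) ^ 2 *
        ∑ q ∈ Finset.range T, cutoff (2 * τ) (k - (q + 1)) * ‖H (q + 1) - H q‖ ^ 2 :=
        Finset.sum_le_sum fun k hk =>
          norm_drift_sq_le hA hQ hvan H (Nat.lt_succ_iff.1 (Finset.mem_range.1 hk))
    _ = 2 * (τ : ℝ) ^ 2 * ∑ q ∈ Finset.range T,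
          (∑ k ∈ Finset.range (T + 1), cutoff (2 * τ) (k - (q + 1))) * ‖H (q + 1) - H q‖ ^ 2 := by
        rw [← Finset.mul_sum, Finset.sum_comm]
        simp_rw [Finset.sum_mul]
    _ ≤ 2 * (τ : ℝ) ^ 2 * ∑ q ∈ Finset.range T, 2 * (τ : ℝ) ^ 2 * ‖H (q + 1) - H q‖ ^ 2 := by
        gcongr with q hq
        exact sum_cutoff_sub_le _ _ _
    _ = _ := by rw [← Finset.mul_sum]; ring

/-- The zeroth increment of `H` is `H 0` and joins the transient; its later increments form the
drift; the noise is summed by parts. -/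
theorem deviation_decomposition {x g H s : ℕ → E} {α : ℝ} (hQA : ∀ k v, Q (A k v) = A k (Q v))
    (hg₀ : g 0 = H 0 + s 0)
    (hg : ∀ k, g (k + 1) = A k (g k) + (H (k + 1) + s (k + 1)) - (H k + s k))
    (hx : ∀ k, x (k + 1) = A k (x k - α • g k)) (k : ℕ) :
    Q (x k) = transition A Q k 0 (x 0 - (α * k) • H 0) - α • drift A Q H k
      - α • ∑ p ∈ Finset.range k, noiseGain A Q k p (s p) := by
  have hinc : ∀ p, increment (fun k => H k + s k) p = increment H p + increment s p := by
    intro p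
    cases p with
    | zero => rfl
    | succ p => simp only [increment]; abel
  rw [deviation_param (G := fun k => H k + s k) hQA hg₀ hg hx k]
  simp only [hinc, map_add, Finset.sum_add_distrib]
  rw [sum_apply_increment_eq_noiseGain s]
  cases k with
  | zero => simp [drift]
  | succ m =>
    rw [Finset.sum_range_succ']
    simp only [drift, increment, LinearMap.smul_apply, map_sub, map_smul, Nat.add_sub_cancel]
    push_cast
    module

theorem consensus_tracker {J : E →ₗ[ℝ] E} {g H s : ℕ → E} (hJA : ∀ k v, J (A k v) = J v)
    (hg₀ : g 0 = H 0 + s 0)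
    (hg : ∀ k, g (k + 1) = A k (g k) + (H (k + 1) + s (k + 1)) - (H k + s k)) (k : ℕ) :
    J (g k) = J (H k + s k) := by
  induction k with
  | zero => rw [hg₀]
  | succ k ih => rw [hg, map_sub, map_add, hJA, ih]; abel

/-- The accumulated consensus error of gradient tracking with finite-time consensus. -/
theorem sum_deviation_sq_le {J : E →ₗ[ℝ] E} {x g H s : ℕ → E} {α L : ℝ} {τ : ℕ}
    (hA : ∀ k v, ‖A k v‖ ≤ ‖v‖) (hQA : ∀ k v, Q (A k v) = A k (Q v))
    (hJA : ∀ k v, J (A k v) = J v) (hpyth : ∀ v, ‖v‖ ^ 2 = ‖Q v‖ ^ 2 + ‖J v‖ ^ 2)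
    (hvan : ∀ k p, p + 2 * τ ≤ k → transition A Q k p = 0)
    (hvan₀ : ∀ k, τ ≤ k → transition A Q k 0 = 0)
    (hg₀ : g 0 = H 0 + s 0)
    (hg : ∀ k, g (k + 1) = A k (g k) + (H (k + 1) + s (k + 1)) - (H k + s k))
    (hx : ∀ k, x (k + 1) = A k (x k - α • g k))
    (hH : ∀ k, ‖H (k + 1) - H k‖ ≤ L * ‖x (k + 1) - x k‖)
    (hα : 48 * α ^ 2 * (τ : ℝ) ^ 4 * L ^ 2 ≤ 1) (T : ℕ) :
    ∑ k ∈ Finset.range (T + 1), ‖Q (x k)‖ ^ 2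
      ≤ 24 * τ * (‖Q (x 0)‖ ^ 2 + α ^ 2 * (τ : ℝ) ^ 2 * ‖Q (H 0)‖ ^ 2)
        + 12 * α ^ 2 * ∑ k ∈ Finset.range (T + 1),
            ‖∑ p ∈ Finset.range k, noiseGain A Q k p (s p)‖ ^ 2
        + α ^ 2 / 2 * ∑ k ∈ Finset.range (T + 1), ‖J (H k + s k)‖ ^ 2 := by
  have hQ : ∀ v, ‖Q v‖ ≤ ‖v‖ := fun v =>
    pow_le_pow_iff_left₀ (norm_nonneg _) (norm_nonneg _) two_ne_zero |>.1 (by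
      rw [hpyth v]; exact le_add_of_nonneg_right (sq_nonneg _))
  have hJg := consensus_tracker hJA hg₀ hg
  have hstep : ∀ q, ‖H (q + 1) - H q‖ ^ 2 ≤ L ^ 2 * (2 * ‖Q (x (q + 1))‖ ^ 2
      + 2 * ‖Q (x q)‖ ^ 2 + α ^ 2 * ‖J (H q + s q)‖ ^ 2) := by
    intro q
    have h1 : ‖H (q + 1) - H q‖ ^ 2 ≤ L ^ 2 * ‖x (q + 1) - x q‖ ^ 2 := by
      rw [← mul_pow]; exact pow_le_pow_left₀ (norm_nonneg _) (hH q) 2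
    have h2 : J (x (q + 1) - x q) = -(α • J (H q + s q)) := by
      rw [map_sub, hx, hJA, map_sub, map_smul, hJg]; abel
    have h3 : ‖J (x (q + 1) - x q)‖ ^ 2 = α ^ 2 * ‖J (H q + s q)‖ ^ 2 := by
      rw [h2, norm_neg, norm_smul, mul_pow, Real.norm_eq_abs, sq_abs]
    have h4 := norm_sub_sq_le_two (Q (x (q + 1))) (Q (x q))
    rw [← map_sub] at h4
    calc _ ≤ _ := h1
      _ ≤ _ := by
        rw [hpyth (x (q + 1) - x q), h3]
        gcongr
  set S := ∑ k ∈ Finset.range (T + 1), ‖Q (x k)‖ ^ 2 with hS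
  set R := ∑ k ∈ Finset.range (T + 1), ‖J (H k + s k)‖ ^ 2 with hR
  set N := ∑ k ∈ Finset.range (T + 1), ‖∑ p ∈ Finset.range k, noiseGain A Q k p (s p)‖ ^ 2 with hN
  set I := ‖Q (x 0)‖ ^ 2 + α ^ 2 * (τ : ℝ) ^ 2 * ‖Q (H 0)‖ ^ 2 with hI
  have hI0 : 0 ≤ I := by positivity
  have hvar : ∑ q ∈ Finset.range T, ‖H (q + 1) - H q‖ ^ 2 ≤ L ^ 2 * (4 * S + α ^ 2 * R) := by
    refine (Finset.sum_le_sum fun q _ => hstep q).trans ?_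
    rw [← Finset.mul_sum, Finset.sum_add_distrib, Finset.sum_add_distrib, ← Finset.mul_sum,
      ← Finset.mul_sum, ← Finset.mul_sum]
    have h1 : ∑ q ∈ Finset.range T, ‖Q (x (q + 1))‖ ^ 2 ≤ S := by
      rw [hS, Finset.sum_range_succ']; exact le_add_of_nonneg_right (sq_nonneg _)
    have h2 : ∑ q ∈ Finset.range T, ‖Q (x q)‖ ^ 2 ≤ S := by
      rw [hS, Finset.sum_range_succ]; exact le_add_of_nonneg_right (sq_nonneg _)
    have h3 : ∑ q ∈ Finset.range T, ‖J (H q + s q)‖ ^ 2 ≤ R := by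
      rw [hR, Finset.sum_range_succ]; exact le_add_of_nonneg_right (sq_nonneg _)
    gcongr
    linarith
  -- The transient survives only during the first cycle, `k < τ`.
  have hinit : ∑ k ∈ Finset.range (T + 1), ‖transition A Q k 0 (x 0 - (α * k) • H 0)‖ ^ 2
      ≤ 2 * τ * I := by
    have h1 : ∀ k, ‖transition A Q k 0 (x 0 - (α * k) • H 0)‖ ^ 2
        ≤ if k < τ then 2 * I else 0 := by
      intro k
      split_ifs with hk
      · have hk' : (k : ℝ) ^ 2 ≤ (τ : ℝ) ^ 2 := by gcongr
        calc _ ≤ ‖Q (x 0 - (α * k) • H 0)‖ ^ 2 :=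
              pow_le_pow_left₀ (norm_nonneg _) (norm_transition_le hA _ _ _) 2
          _ ≤ 2 * ‖Q (x 0)‖ ^ 2 + 2 * ‖(α * k) • Q (H 0)‖ ^ 2 := by
              rw [map_sub, map_smul]; exact norm_sub_sq_le_two _ _
          _ = 2 * (‖Q (x 0)‖ ^ 2 + α ^ 2 * (k : ℝ) ^ 2 * ‖Q (H 0)‖ ^ 2) := by
              rw [norm_smul, mul_pow, Real.norm_eq_abs, sq_abs]; ring
          _ ≤ _ := by rw [hI]; gcongr
      · rw [hvan₀ k (by omega)]; simp
    refine (Finset.sum_le_sum fun k _ => h1 k).trans ?_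
    rw [← Finset.sum_filter, Finset.sum_const, nsmul_eq_mul]
    have h2 : ((Finset.range (T + 1)).filter (· < τ)).card ≤ τ := by
      refine (Finset.card_le_card (t := Finset.range τ) fun k hk => ?_).trans
        (Finset.card_range τ).le
      exact Finset.mem_range.2 (Finset.mem_filter.1 hk).2
    calc _ ≤ (τ : ℝ) * (2 * I) := by gcongr
      _ = _ := by ring
  have hdrift := sum_norm_drift_sq_le hA hQ hvan H T
  have hmain : S ≤ 2 * α ^ 2 * (∑ k ∈ Finset.range (T + 1), ‖drift A Q H k‖ ^ 2)
      + 4 * (2 * τ * I) + 4 * α ^ 2 * N := by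
    -- The drift receives the small weight 2 (against 4 and 4), because it is the term to be
    -- absorbed on the left.
    have h1 : ∀ k, ‖Q (x k)‖ ^ 2 ≤ 2 * α ^ 2 * ‖drift A Q H k‖ ^ 2
        + 4 * ‖transition A Q k 0 (x 0 - (α * k) • H 0)‖ ^ 2
        + 4 * α ^ 2 * ‖∑ p ∈ Finset.range k, noiseGain A Q k p (s p)‖ ^ 2 := by
      intro k
      rw [deviation_decomposition hQA hg₀ hg hx k]
      refine (norm_sub_sub_sq_le _ _ _).trans (le_of_eq ?_)
      rw [norm_smul, norm_smul, mul_pow, mul_pow, Real.norm_eq_abs, sq_abs]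
      ring
    refine (Finset.sum_le_sum fun k _ => h1 k).trans ?_
    rw [Finset.sum_add_distrib, Finset.sum_add_distrib, ← Finset.mul_sum, ← Finset.mul_sum,
      ← Finset.mul_sum]
    gcongr
  have hS0 : 0 ≤ S := Finset.sum_nonneg fun _ _ => sq_nonneg _
  have hR0 : 0 ≤ R := Finset.sum_nonneg fun _ _ => sq_nonneg _
  -- As `2 · 4 = 48 / 6`, the drift costs `(2/3) S + α² R / 6`. Moving `(2/3) S` to the left and
  -- multiplying by 3 yields the constants 24, 12 and 1/2.
  have h5 : 2 * α ^ 2 * (∑ k ∈ Finset.range (T + 1), ‖drift A Q H k‖ ^ 2)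
      ≤ 1 / 6 * (4 * S + α ^ 2 * R) := by
    calc _ ≤ 2 * α ^ 2 * (4 * (τ : ℝ) ^ 4 * (L ^ 2 * (4 * S + α ^ 2 * R))) := by
          gcongr
          exact hdrift.trans (by gcongr)
      _ = 1 / 6 * (48 * α ^ 2 * (τ : ℝ) ^ 4 * L ^ 2) * (4 * S + α ^ 2 * R) := by ring
      _ ≤ 1 / 6 * 1 * (4 * S + α ^ 2 * R) := by gcongr
      _ = _ := by ring
  linarith

end Consensus

/-! ### Doubly stochastic matrices and finite-time consensus on stacked vectors -/

section Mixing

variable {n d : ℕ}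

/-- The vectors of all agents, stacked with the Euclidean norm. -/
abbrev Stack (n d : ℕ) : Type := PiLp 2 fun _ : Fin n => Vec d

/-- The action of a mixing matrix on stacked vectors. -/
def mixing (d : ℕ) (M : Matrix (Fin n) (Fin n) ℝ) : Stack n d →ₗ[ℝ] Stack n d where
  toFun v := WithLp.toLp 2 fun i => ∑ j, M i j • v j
  map_add' v w := by
    ext1 i
    simp [smul_add, Finset.sum_add_distrib]
  map_smul' c v := by
    ext1 i
    simp [Finset.smul_sum, smul_comm c]

theorem mixing_apply (M : Matrix (Fin n) (Fin n) ℝ) (v : Stack n d) (i : Fin n) :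
    mixing d M v i = ∑ j, M i j • v j := rfl

theorem mixing_mul (M N : Matrix (Fin n) (Fin n) ℝ) :
    mixing d (M * N) = mixing d M ∘ₗ mixing d N := by
  ext1 v
  ext1 i
  simp only [LinearMap.comp_apply, mixing_apply, Matrix.mul_apply, Finset.sum_smul,
    Finset.smul_sum, mul_smul]
  exact Finset.sum_comm

theorem mixing_one : mixing d (1 : Matrix (Fin n) (Fin n) ℝ) = LinearMap.id := by
  ext1 v
  ext1 i
  simp [mixing_apply, Matrix.one_apply]

/-- Convexity of the squared norm along each row, using unit row sums; unit column sums then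
collapse the double sum. -/
theorem norm_mixing_le {M : Matrix (Fin n) (Fin n) ℝ} (hM : M ∈ doublyStochastic ℝ (Fin n))
    (v : Stack n d) : ‖mixing d M v‖ ≤ ‖v‖ := by
  obtain ⟨h0, hrow, hcol⟩ := mem_doublyStochastic_iff_sum.1 hM
  refine pow_le_pow_iff_left₀ (norm_nonneg _) (norm_nonneg _) two_ne_zero |>.1 ?_
  rw [PiLp.norm_sq_eq_of_L2, PiLp.norm_sq_eq_of_L2]
  have h1 : ∀ i, ‖mixing d M v i‖ ^ 2 ≤ ∑ j, M i j * ‖v j‖ ^ 2 := by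
    intro i
    have h2 : ‖mixing d M v i‖ ≤ ∑ j, M i j * ‖v j‖ := by
      rw [mixing_apply]
      refine (norm_sum_le _ _).trans (le_of_eq (Finset.sum_congr rfl fun j _ => ?_))
      rw [norm_smul, Real.norm_of_nonneg (h0 i j)]
    calc _ ≤ (∑ j, M i j * ‖v j‖) ^ 2 := pow_le_pow_left₀ (norm_nonneg _) h2 2
      _ ≤ (∑ j, M i j) * ∑ j, M i j * ‖v j‖ ^ 2 :=
        Finset.sum_sq_le_sum_mul_sum_of_sq_le_mul _ (fun j _ => h0 i j)
          (fun j _ => mul_nonneg (h0 i j) (sq_nonneg _)) fun _ _ => by ring_nf; rfl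
      _ = _ := by rw [hrow, one_mul]
  refine (Finset.sum_le_sum fun i _ => h1 i).trans (le_of_eq ?_)
  rw [Finset.sum_comm]
  refine Finset.sum_congr rfl fun j _ => ?_
  rw [← Finset.sum_mul, hcol, one_mul]

/-- Replacing the vectors of all agents by their average. -/
noncomputable def consensus (n d : ℕ) : Stack n d →ₗ[ℝ] Stack n d :=
  mixing d (Matrix.of fun _ _ => (1 : ℝ) / n)

/-- The deviation of the vectors of the agents from their average. -/
noncomputable def deviation (n d : ℕ) : Stack n d →ₗ[ℝ] Stack n d := LinearMap.id - consensus n d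

theorem consensus_apply (v : Stack n d) (i : Fin n) : consensus n d v i = avg fun j => v j := by
  simp [consensus, mixing_apply, avg, Finset.smul_sum]

theorem deviation_apply (v : Stack n d) (i : Fin n) :
    deviation n d v i = v i - avg fun j => v j := by
  rw [← consensus_apply v i]; rfl

theorem nsmul_avg (hn : 1 ≤ n) (v : Fin n → Vec d) : (n : ℝ) • avg v = ∑ i, v i := by
  have : (n : ℝ) ≠ 0 := by positivity
  rw [avg, smul_smul, mul_one_div_cancel this, one_smul]

theorem avg_const (hn : 1 ≤ n) (v : Vec d) : (avg fun _ : Fin n => v) = v := by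
  have : (n : ℝ) ≠ 0 := by positivity
  rw [avg, Finset.sum_const, Finset.card_univ, Fintype.card_fin, ← Nat.cast_smul_eq_nsmul ℝ,
    smul_smul, one_div_mul_cancel this, one_smul]

theorem avg_add (v w : Fin n → Vec d) : (avg fun i => v i + w i) = avg v + avg w := by
  simp [avg, Finset.sum_add_distrib]

theorem avg_sub (v w : Fin n → Vec d) : (avg fun i => v i - w i) = avg v - avg w := by
  simp [avg, Finset.sum_sub_distrib, smul_sub]

theorem norm_avg_sq_le (hn : 1 ≤ n) (v : Fin n → Vec d) :
    ‖avg v‖ ^ 2 ≤ 1 / n * ∑ i, ‖v i‖ ^ 2 := by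
  have hn' : (0 : ℝ) < n := by exact_mod_cast hn
  have h : ‖∑ i, v i‖ ^ 2 ≤ n * ∑ i, ‖v i‖ ^ 2 := by
    calc _ ≤ (∑ i, ‖v i‖) ^ 2 := pow_le_pow_left₀ (norm_nonneg _) (norm_sum_le _ _) 2
      _ ≤ _ := by simpa using sq_sum_le_card_mul_sum_sq (s := Finset.univ) (f := fun i => ‖v i‖)
  rw [avg, norm_smul, mul_pow, Real.norm_of_nonneg (by positivity)]
  calc _ ≤ (1 / (n : ℝ)) ^ 2 * (n * ∑ i, ‖v i‖ ^ 2) := by gcongr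
    _ = _ := by field_simp

theorem norm_consensus_sq (v : Stack n d) :
    ‖consensus n d v‖ ^ 2 = n * ‖avg fun j => v j‖ ^ 2 := by
  simp [PiLp.norm_sq_eq_of_L2, consensus_apply]

theorem norm_sq_eq_deviation_add_consensus (hn : 1 ≤ n) (v : Stack n d) :
    ‖v‖ ^ 2 = ‖deviation n d v‖ ^ 2 + ‖consensus n d v‖ ^ 2 := by
  have h0 : inner ℝ (deviation n d v) (consensus n d v) = 0 := by
    rw [PiLp.inner_apply]
    simp only [deviation_apply, consensus_apply]
    rw [← sum_inner, Finset.sum_sub_distrib, ← nsmul_avg hn, Finset.sum_const, Finset.card_univ,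
      Fintype.card_fin, Nat.cast_smul_eq_nsmul, sub_self, inner_zero_left]
  have h1 : v = deviation n d v + consensus n d v := by simp [deviation]
  conv_lhs => rw [h1, norm_add_sq_real, h0]
  ring

theorem consensus_mixing {M : Matrix (Fin n) (Fin n) ℝ} (hM : M ∈ doublyStochastic ℝ (Fin n))
    (v : Stack n d) : consensus n d (mixing d M v) = consensus n d v := by
  obtain ⟨-, -, hcol⟩ := mem_doublyStochastic_iff_sum.1 hM
  ext1 i
  simp only [consensus_apply, avg, mixing_apply]
  rw [Finset.sum_comm]
  simp_rw [← Finset.sum_smul, hcol, one_smul]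

theorem mixing_consensus {M : Matrix (Fin n) (Fin n) ℝ} (hM : M ∈ doublyStochastic ℝ (Fin n))
    (v : Stack n d) : mixing d M (consensus n d v) = consensus n d v := by
  obtain ⟨-, hrow, -⟩ := mem_doublyStochastic_iff_sum.1 hM
  ext1 i
  simp only [mixing_apply, consensus_apply]
  rw [← Finset.sum_smul, hrow, one_smul]

theorem deviation_mixing {M : Matrix (Fin n) (Fin n) ℝ} (hM : M ∈ doublyStochastic ℝ (Fin n))
    (v : Stack n d) : deviation n d (mixing d M v) = mixing d M (deviation n d v) := by
  simp only [deviation, LinearMap.sub_apply, LinearMap.id_apply, map_sub, consensus_mixing hM,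
    mixing_consensus hM]

theorem consensus_deviation (hn : 1 ≤ n) (v : Stack n d) :
    consensus n d (deviation n d v) = 0 := by
  ext1 i
  rw [consensus_apply]
  simp only [deviation_apply]
  rw [avg_sub, avg_const hn, sub_self]
  rfl

/-- The mixing operator of iteration `k`, with the matrices `W 0, …, W (τ-1)` used cyclically. -/
def cyclicMixing (d τ : ℕ) (W : ℕ → Matrix (Fin n) (Fin n) ℝ) (k : ℕ) : Stack n d →ₗ[ℝ] Stack n d :=
  mixing d (W (k % τ))

variable {τ : ℕ} {W : ℕ → Matrix (Fin n) (Fin n) ℝ}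

theorem FiniteTimeConsensus.mod_mem (h : FiniteTimeConsensus τ W) (k : ℕ) :
    W (k % τ) ∈ _root_.doublyStochastic ℝ (Fin n) :=
  h.doublyStochastic _ (Nat.mod_lt _ h.one_le)

/-- From a multiple of `τ` on, the cycle restarts at `W 0`, so the ordered product appears. -/
theorem transition_add_eq_mixing (m p r : ℕ) (hp : p ≤ m * τ) (hr : r ≤ τ) :
    transition (cyclicMixing d τ W) (deviation n d) (m * τ + r) p
      = mixing d (orderedProd W r)
        ∘ₗ transition (cyclicMixing d τ W) (deviation n d) (m * τ) p := by
  induction r with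
  | zero => rw [orderedProd, mixing_one, LinearMap.id_comp, add_zero]
  | succ r ih =>
    rw [← add_assoc, transition_succ (by omega), ih (by omega), orderedProd, mixing_mul,
      LinearMap.comp_assoc, cyclicMixing]
    congr 3
    rw [Nat.mul_add_mod', Nat.mod_eq_of_lt hr]

theorem consensus_transition (h : FiniteTimeConsensus τ W) (hn : 1 ≤ n) (k p : ℕ) (v : Stack n d) :
    consensus n d (transition (cyclicMixing d τ W) (deviation n d) k p v) = 0 := by
  induction k with
  | zero => exact consensus_deviation hn v
  | succ k ih =>
    rw [transition]
    split_ifs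
    · rw [LinearMap.comp_apply, cyclicMixing, consensus_mixing (h.mod_mem k), ih]
    · exact consensus_deviation hn v

/-- Over a complete cycle the mixing operator is exact averaging, which annihilates deviations, and
mixing keeps deviations average-free. -/
theorem transition_period_eq_zero (h : FiniteTimeConsensus τ W) (hn : 1 ≤ n) {m p k : ℕ}
    (hp : p ≤ m * τ) (hk : m * τ + τ ≤ k) :
    transition (cyclicMixing d τ W) (deviation n d) k p = 0 := by
  refine transition_eq_zero_of_le (by omega) hk ?_
  rw [transition_add_eq_mixing m p τ hp le_rfl, h.exact_averaging]
  ext1 v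
  exact consensus_transition h hn _ _ v

theorem transition_eq_zero (h : FiniteTimeConsensus τ W) (hn : 1 ≤ n) {p k : ℕ}
    (hk : p + 2 * τ ≤ k) : transition (cyclicMixing d τ W) (deviation n d) k p = 0 := by
  have hτ := h.one_le
  have h1 := Nat.div_add_mod (p + τ - 1) τ
  have h2 := Nat.mod_lt (p + τ - 1) hτ
  rw [mul_comm] at h1
  -- `m` is `p / τ` rounded up: the first cycle starting at or after `p` ends before `p + 2 * τ`.
  exact transition_period_eq_zero h hn (m := (p + τ - 1) / τ) (by omega) (by omega)

theorem transition_zero_eq_zero (h : FiniteTimeConsensus τ W) (hn : 1 ≤ n) {k : ℕ}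
    (hk : τ ≤ k) : transition (cyclicMixing d τ W) (deviation n d) k 0 = 0 :=
  transition_period_eq_zero h hn (m := 0) (by omega) (by omega)

end Mixing

/-! ### Descent lemma for Lipschitz gradients -/

section Descent

variable {V : Type*} [NormedAddCommGroup V] [InnerProductSpace ℝ V] [CompleteSpace V]

theorem le_add_inner_add_sq_of_lipschitz_gradient {f : V → ℝ} {f' : V → V} {L : ℝ}
    (hf : ∀ x, HasGradientAt f (f' x) x) (hL : ∀ x y, ‖f' x - f' y‖ ≤ L * ‖x - y‖) (x y : V) :
    f y ≤ f x + inner ℝ (f' x) (y - x) + L / 2 * ‖y - x‖ ^ 2 := by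
  set v := y - x with hv
  set φ : ℝ → ℝ := fun t => f (x + t • v) - t * inner ℝ (f' x) v - L / 2 * ‖v‖ ^ 2 * t ^ 2 with hφ
  have hderiv : ∀ t, HasDerivAt φ
      (inner ℝ (f' (x + t • v)) v - inner ℝ (f' x) v - L * ‖v‖ ^ 2 * t) t := by
    intro t
    have h1 : HasDerivAt (fun t : ℝ => x + t • v) v t := by
      simpa using ((hasDerivAt_id t).smul_const v).const_add x
    have h2 := (hf (x + t • v)).hasFDerivAt.comp_hasDerivAt t h1
    have h3 := (hasDerivAt_id t).mul_const (inner ℝ (f' x) v)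
    have h4 := ((hasDerivAt_id t).pow 2).const_mul (L / 2 * ‖v‖ ^ 2)
    refine ((h2.sub h3).sub h4).congr_deriv ?_
    simp
    ring
  have hanti : AntitoneOn φ (Set.Icc 0 1) := by
    refine antitoneOn_of_deriv_nonpos (convex_Icc 0 1)
      (fun t _ => (hderiv t).continuousAt.continuousWithinAt)
      (fun t _ => (hderiv t).differentiableAt.differentiableWithinAt) fun t ht => ?_
    rw [interior_Icc] at ht
    rw [(hderiv t).deriv, ← inner_sub_left]
    have h1 : ‖f' (x + t • v) - f' x‖ ≤ L * (t * ‖v‖) := by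
      have := hL (x + t • v) x
      rwa [add_sub_cancel_left, norm_smul, Real.norm_of_nonneg ht.1.le] at this
    have h2 : inner ℝ (f' (x + t • v) - f' x) v ≤ L * (t * ‖v‖) * ‖v‖ :=
      (real_inner_le_norm _ _).trans (mul_le_mul_of_nonneg_right h1 (norm_nonneg _))
    nlinarith
  have h := hanti (Set.left_mem_Icc.2 zero_le_one) (Set.right_mem_Icc.2 zero_le_one) zero_le_one
  simp only [hφ, one_smul, zero_smul, add_zero, hv, add_sub_cancel] at h
  rw [hv]
  linarith

/-- The descent lemma for the step `-f' x / L` shows how far `f` can be decreased, and it cannot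
fall below `m`. -/
theorem norm_gradient_sq_le {f : V → ℝ} {f' : V → V} {L m : ℝ} (hL0 : 0 < L)
    (hf : ∀ x, HasGradientAt f (f' x) x) (hL : ∀ x y, ‖f' x - f' y‖ ≤ L * ‖x - y‖)
    (hm : ∀ x, m ≤ f x) (x : V) : ‖f' x‖ ^ 2 ≤ 2 * L * (f x - m) := by
  have h := le_add_inner_add_sq_of_lipschitz_gradient hf hL x (x - (1 / L) • f' x)
  rw [sub_sub_cancel_left, inner_neg_right, norm_neg, norm_smul, real_inner_smul_right,
    real_inner_self_eq_norm_sq, mul_pow, Real.norm_of_nonneg (by positivity)] at h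
  have h2 := (hm _).trans h
  have h3 : L / 2 * ((1 / L) ^ 2 * ‖f' x‖ ^ 2) = 1 / L * ‖f' x‖ ^ 2 / 2 := by
    field_simp
  rw [h3] at h2
  have h4 : 1 / L * ‖f' x‖ ^ 2 ≤ 2 * (f x - m) := by linarith
  calc ‖f' x‖ ^ 2 = L * (1 / L * ‖f' x‖ ^ 2) := by field_simp
    _ ≤ L * (2 * (f x - m)) := by gcongr
    _ = _ := by ring

end Descent

/-! ### Smoothness of the objective and one inexact gradient step -/

section Problem

variable {n d : ℕ} {Ξ : Fin n → Type*} [∀ i, MeasurableSpace (Ξ i)]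
  {F : ∀ i, Vec d → Ξ i → ℝ} {P : ∀ i, Measure (Ξ i)} {L : ℝ}

theorem Smooth.continuous_gradient (h : Smooth F P L) (i : Fin n) :
    Continuous (gradient (localObj F P i)) := by
  refine (LipschitzWith.of_dist_le_mul (K := ⟨L, h.pos.le⟩) fun x y => ?_).continuous
  rw [dist_eq_norm, dist_eq_norm]
  exact h.lipschitz i x y

theorem Smooth.hasGradientAt_objective (h : Smooth F P L) (x : Vec d) :
    HasGradientAt (objective F P) (avg fun i => gradient (localObj F P i) x) x := by
  have h1 : ∀ i, HasFDerivAt (localObj F P i)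
      (InnerProductSpace.toDual ℝ (Vec d) (gradient (localObj F P i) x)) x := fun i =>
    (((h.contDiff i).differentiable one_ne_zero) x).hasGradientAt.hasFDerivAt
  have h2 := (HasFDerivAt.fun_sum fun i (_ : i ∈ Finset.univ) => h1 i).const_mul (1 / (n : ℝ))
  rw [hasGradientAt_iff_hasFDerivAt, avg, map_smul, map_sum]
  exact h2

theorem Smooth.gradient_objective (h : Smooth F P L) (x : Vec d) :
    gradient (objective F P) x = avg fun i => gradient (localObj F P i) x :=
  (h.hasGradientAt_objective x).gradient

theorem Smooth.hasGradientAt (h : Smooth F P L) (x : Vec d) :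
    HasGradientAt (objective F P) (gradient (objective F P) x) x :=
  (h.hasGradientAt_objective x).differentiableAt.hasGradientAt

theorem Smooth.lipschitz_objective (h : Smooth F P L) (hn : 1 ≤ n) (x y : Vec d) :
    ‖gradient (objective F P) x - gradient (objective F P) y‖ ≤ L * ‖x - y‖ := by
  have hn' : (0 : ℝ) < n := by exact_mod_cast hn
  rw [h.gradient_objective, h.gradient_objective, ← avg_sub, avg, norm_smul,
    Real.norm_of_nonneg (by positivity)]
  calc _ ≤ 1 / (n : ℝ) * ∑ _i : Fin n, L * ‖x - y‖ := by
        gcongr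
        exact (norm_sum_le _ _).trans (Finset.sum_le_sum fun i _ => h.lipschitz i x y)
    _ = _ := by simp; field_simp

theorem Smooth.continuous_gradient_objective (h : Smooth F P L) :
    Continuous (gradient (objective F P)) := by
  rw [funext h.gradient_objective]
  have h1 : Continuous fun x => ∑ i, gradient (localObj F P i) x :=
    continuous_finsetSum _ fun i _ => h.continuous_gradient i
  exact h1.const_smul (1 / (n : ℝ))

theorem Smooth.continuous_objective (h : Smooth F P L) : Continuous (objective F P) :=
  continuous_iff_continuousAt.2 fun x => (h.hasGradientAt x).continuousAt

theorem Smooth.optValue_le (h : Smooth F P L) (x : Vec d) : optValue F P ≤ objective F P x :=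
  ciInf_le h.bddBelow x

theorem Smooth.norm_gradient_objective_sq_le (h : Smooth F P L) (hn : 1 ≤ n) (x : Vec d) :
    ‖gradient (objective F P) x‖ ^ 2 ≤ 2 * L * (objective F P x - optValue F P) :=
  norm_gradient_sq_le h.pos h.hasGradientAt (h.lipschitz_objective hn) h.optValue_le x

theorem Smooth.norm_avgGrad_sub_sq_le (h : Smooth F P L) (hn : 1 ≤ n) (x : Fin n → Vec d) :
    ‖avgGrad F P x - gradient (objective F P) (avg x)‖ ^ 2
      ≤ L ^ 2 * (1 / n * ∑ i, ‖x i - avg x‖ ^ 2) := by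
  rw [h.gradient_objective, avgGrad, ← avg_sub]
  refine (norm_avg_sq_le hn _).trans ?_
  calc _ ≤ 1 / (n : ℝ) * ∑ i, L ^ 2 * ‖x i - avg x‖ ^ 2 := by
        gcongr with i
        rw [← mul_pow]
        exact pow_le_pow_left₀ (norm_nonneg _) (h.lipschitz i _ _) 2
    _ = _ := by rw [← Finset.mul_sum]; ring

/-- One inexact gradient step of size `α ≤ 1 / (2L)`, with direction `u + e`, where `u` is the
average of the local gradients. -/
theorem Smooth.objective_step_le (h : Smooth F P L) (hn : 1 ≤ n) {α : ℝ} (hα : 0 ≤ α)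
    (x : Fin n → Vec d) (e : Vec d) :
    objective F P (avg x - α • (avgGrad F P x + e)) ≤ objective F P (avg x)
      - α / 2 * ‖gradient (objective F P) (avg x)‖ ^ 2
      - α / 2 * (1 - L * α) * ‖avgGrad F P x‖ ^ 2
      + α / 2 * (L ^ 2 * (1 / n * ∑ i, ‖x i - avg x‖ ^ 2))
      + L * α ^ 2 / 2 * ‖e‖ ^ 2
      + (L * α ^ 2 * inner ℝ (avgGrad F P x) e
        - α * inner ℝ (gradient (objective F P) (avg x)) e) := by
  have h1 := le_add_inner_add_sq_of_lipschitz_gradient h.hasGradientAt (h.lipschitz_objective hn)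
    (avg x) (avg x - α • (avgGrad F P x + e))
  have h2 := h.norm_avgGrad_sub_sq_le hn x
  set u := avgGrad F P x
  set v := gradient (objective F P) (avg x)
  rw [sub_sub_cancel_left, inner_neg_right, norm_neg, norm_smul, real_inner_smul_right,
    inner_add_right, mul_pow, norm_add_sq_real, Real.norm_of_nonneg hα] at h1
  -- Polarization trades the inner product of `u` and `v` for `‖u‖²`, `‖v‖²` and `‖u - v‖²`; the
  -- last is at most `L²` times the consensus error.
  rw [norm_sub_sq_real, real_inner_comm] at h2
  have h3 := mul_le_mul_of_nonneg_left h2 (by positivity : 0 ≤ α / 2)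
  linarith

end Problem

/-! ### Orthogonality from independence -/

section Independence

variable {Ω α β γ : Type*} [MeasurableSpace Ω] [MeasurableSpace α] [MeasurableSpace β]
  [MeasurableSpace γ] {μ : Measure Ω} [IsProbabilityMeasure μ]

/-- The hypotheses make the joint law a triple product measure, which may be reassociated. -/
theorem indepFun_prodMk_of_indepFun {U : Ω → α} {V : Ω → β} {Z : Ω → γ} (hU : Measurable U)
    (hV : Measurable V) (hZ : Measurable Z) (h : IndepFun U (fun ω => (V ω, Z ω)) μ)
    (hVZ : IndepFun V Z μ) : IndepFun (fun ω => (U ω, V ω)) Z μ := by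
  have : IsProbabilityMeasure (μ.map U) := Measure.isProbabilityMeasure_map hU.aemeasurable
  have : IsProbabilityMeasure (μ.map V) := Measure.isProbabilityMeasure_map hV.aemeasurable
  have : IsProbabilityMeasure (μ.map Z) := Measure.isProbabilityMeasure_map hZ.aemeasurable
  have hUV : IndepFun U V μ := h.comp measurable_id measurable_fst
  rw [indepFun_iff_map_prod_eq_prod_map_map (by fun_prop) (by fun_prop)] at h hVZ hUV ⊢
  rw [hUV]
  rw [hVZ, ← Measure.prodAssoc_prod] at h
  apply MeasurableEquiv.prodAssoc.map_measurableEquiv_injective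
  rw [← h, Measure.map_map MeasurableEquiv.prodAssoc.measurable (by fun_prop)]
  rfl

variable {V : Type*} [NormedAddCommGroup V] [InnerProductSpace ℝ V] [CompleteSpace V]
  [MeasurableSpace V] [BorelSpace V] [SecondCountableTopology V]

omit [BorelSpace V] in
theorem integral_prod_eq_zero_ae {ν : Measure V} {ρ : Measure γ} [IsProbabilityMeasure ν]
    [IsProbabilityMeasure ρ] {φ : V × γ → V} (hint : Integrable φ (ν.prod ρ))
    (h0 : ∀ B, MeasurableSet B → ∫ p in B ×ˢ Set.univ, φ p ∂(ν.prod ρ) = 0) :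
    ∀ᵐ v ∂ν, ∫ z, φ (v, z) ∂ρ = 0 := by
  refine Integrable.ae_eq_zero_of_forall_setIntegral_eq_zero hint.integral_prod_left
    fun B hB _ => ?_
  rw [← h0 B hB, setIntegral_prod _ hint.integrableOn]
  simp

/-- If `Z` is independent of a σ-algebra for which `x` and `u` are measurable, and the integral of
`φ (x, Z)` vanishes over every event that is determined by `x`, then `φ (x, Z)` is orthogonal
to `u`. -/
theorem integral_inner_eq_zero_of_indep {Ω : Type*} {G mΩ : MeasurableSpace Ω} {μ : Measure Ω}
    [IsProbabilityMeasure μ] {Z : Ω → γ} (hG : G ≤ mΩ) (hZ : Measurable Z)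
    (hind : Indep G (MeasurableSpace.comap Z inferInstance) μ)
    {x u : Ω → V} (hx : Measurable[G] x) (hu : Measurable[G] u) {φ : V × γ → V}
    (hφ : Measurable φ) (hint : Integrable (fun ω => φ (x ω, Z ω)) μ)
    (hint' : Integrable (fun ω => inner ℝ (u ω) (φ (x ω, Z ω))) μ)
    (h0 : ∀ B, MeasurableSet B → ∫ ω in x ⁻¹' B, φ (x ω, Z ω) ∂μ = 0) :
    ∫ ω, inner ℝ (u ω) (φ (x ω, Z ω)) ∂μ = 0 := by
  have hx' : Measurable x := hx.mono hG le_rfl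
  have hu' : Measurable u := hu.mono hG le_rfl
  have hux : Measurable fun ω => (x ω, u ω) := hx'.prodMk hu'
  have hindep : IndepFun (fun ω => (x ω, u ω)) Z μ :=
    indep_of_indep_of_le_left hind (Measurable.comap_le (hx.prodMk hu))
  have hindep' : IndepFun x Z μ := hindep.comp measurable_fst measurable_id
  have : IsProbabilityMeasure (μ.map x) := Measure.isProbabilityMeasure_map hx'.aemeasurable
  have : IsProbabilityMeasure (μ.map Z) := Measure.isProbabilityMeasure_map hZ.aemeasurable
  have : IsProbabilityMeasure (μ.map fun ω => (x ω, u ω)) :=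
    Measure.isProbabilityMeasure_map hux.aemeasurable
  have hmap := (indepFun_iff_map_prod_eq_prod_map_map hux.aemeasurable hZ.aemeasurable).1 hindep
  have hmap' := (indepFun_iff_map_prod_eq_prod_map_map hx'.aemeasurable hZ.aemeasurable).1 hindep'
  have hint1 : Integrable φ ((μ.map x).prod (μ.map Z)) := by
    rw [← hmap']
    exact (integrable_map_measure hφ.aestronglyMeasurable (hx'.prodMk hZ).aemeasurable).2 hint
  -- This statement concerns only the laws of `x` and `Z`. Hence `u` may carry information beyond
  -- `x`, provided it is independent of `Z` jointly with `x`.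
  have hzero : ∀ᵐ v ∂μ.map x, ∫ z, φ (v, z) ∂(μ.map Z) = 0 := by
    refine integral_prod_eq_zero_ae hint1 fun B hB => ?_
    rw [← hmap', setIntegral_map (hB.prod MeasurableSet.univ) hφ.aestronglyMeasurable
      (hx'.prodMk hZ).aemeasurable, ← h0 B hB]
    congr 2
    ext ω
    simp
  have hψ : Measurable fun p : (V × V) × γ => inner ℝ p.1.2 (φ (p.1.1, p.2)) :=
    (measurable_snd.comp measurable_fst).inner
      (hφ.comp ((measurable_fst.comp measurable_fst).prodMk measurable_snd))
  have hint2 : Integrable (fun p : (V × V) × γ => inner ℝ p.1.2 (φ (p.1.1, p.2)))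
      ((μ.map fun ω => (x ω, u ω)).prod (μ.map Z)) := by
    rw [← hmap]
    exact (integrable_map_measure hψ.aestronglyMeasurable (hux.prodMk hZ).aemeasurable).2 hint'
  have hstep : ∫ ω, inner ℝ (u ω) (φ (x ω, Z ω)) ∂μ
      = ∫ p, inner ℝ p.1.2 (φ (p.1.1, p.2)) ∂((μ.map fun ω => (x ω, u ω)).prod (μ.map Z)) := by
    rw [← hmap, integral_map (hux.prodMk hZ).aemeasurable hψ.aestronglyMeasurable]
  rw [hstep, integral_prod _ hint2]
  have hfst : (μ.map fun ω => (x ω, u ω)).map Prod.fst = μ.map x := by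
    rw [Measure.map_map measurable_fst hux]; rfl
  have hz2 : ∀ᵐ p ∂(μ.map fun ω => (x ω, u ω)), ∫ z, φ (p.1, z) ∂(μ.map Z) = 0 := by
    rw [← hfst] at hzero
    exact ae_of_ae_map measurable_fst.aemeasurable hzero
  have hi2 : ∀ᵐ p ∂(μ.map fun ω => (x ω, u ω)), Integrable (fun z => φ (p.1, z)) (μ.map Z) := by
    have := hint1.prod_right_ae
    rw [← hfst] at this
    exact ae_of_ae_map measurable_fst.aemeasurable this
  refine integral_eq_zero_of_ae ?_
  filter_upwards [hz2, hi2] with p hp hpi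
  simp only [Pi.zero_apply]
  rw [integral_inner hpi, hp, inner_zero_right]

end Independence

/-! ### Measurability, independence and moments of the gradient noise -/

section Noise

variable {n d : ℕ} {Ξ : Fin n → Type*} [∀ i, MeasurableSpace (Ξ i)]
  {F : ∀ i, Vec d → Ξ i → ℝ} {P : ∀ i, Measure (Ξ i)} {L σ α : ℝ} {τ : ℕ}
  {W : ℕ → Matrix (Fin n) (Fin n) ℝ}

/-- Parameters at time `k` use samples strictly before `k`, trackers also those at `k`. The
σ-algebra on `Ω` is arbitrary so that the result applies to `otherSamples` too. -/
theorem measurable_iter {Ω : Type*} [MeasurableSpace Ω] (hF : WellPosed F P)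
    {x₀ : Ω → Fin n → Vec d} {ξ : ℕ → ∀ i, Ω → Ξ i} (hx₀ : Measurable x₀) (k : ℕ) :
    ((∀ l < k, ∀ i, Measurable (ξ l i)) →
        Measurable fun ω => (iter F τ W α (x₀ ω) (fun k i => ξ k i ω) k).1) ∧
      ((∀ l ≤ k, ∀ i, Measurable (ξ l i)) →
        Measurable fun ω => (iter F τ W α (x₀ ω) (fun k i => ξ k i ω) k).2) := by
  induction k with
  | zero =>
    refine ⟨fun _ => hx₀, fun h => measurable_pi_lambda _ fun i => ?_⟩
    exact (hF.measurable_grad i).comp (((measurable_pi_apply i).comp hx₀).prodMk (h 0 le_rfl i))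
  | succ k ih =>
    have hx : (∀ l < k + 1, ∀ i, Measurable (ξ l i)) →
        Measurable fun ω => (iter F τ W α (x₀ ω) (fun k i => ξ k i ω) (k + 1)).1 := by
      intro h
      have h1 := ih.1 fun l hl => h l (by omega)
      have h2 := ih.2 fun l hl => h l (by omega)
      refine measurable_pi_lambda _ fun i => ?_
      change Measurable fun ω => ∑ j, W (k % τ) i j •
        ((iter F τ W α (x₀ ω) (fun k i => ξ k i ω) k).1 j
          - α • (iter F τ W α (x₀ ω) (fun k i => ξ k i ω) k).2 j)
      refine Finset.measurable_fun_sum _ fun j _ => ?_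
      exact (((measurable_pi_apply j).comp h1).sub
        (((measurable_pi_apply j).comp h2).const_smul α)).const_smul (W (k % τ) i j)
    refine ⟨hx, fun h => ?_⟩
    have h1 := ih.1 fun l hl => h l (by omega)
    have h2 := ih.2 fun l hl => h l (by omega)
    have h3 := hx fun l hl => h l (by omega)
    refine measurable_pi_lambda _ fun i => ?_
    refine ((Finset.measurable_fun_sum _ fun j _ =>
      (((measurable_pi_apply j).comp h2).const_smul (W (k % τ) i j))).add ?_).sub ?_
    · exact (hF.measurable_grad i).comp
        (((measurable_pi_apply i).comp h3).prodMk (h (k + 1) le_rfl i))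
    · exact (hF.measurable_grad i).comp
        (((measurable_pi_apply i).comp h1).prodMk (h k (by omega) i))

variable {Ω : Type*}

/-- The stochastic gradient noise of the agents at iteration `k`. -/
noncomputable def noise (F : ∀ i, Vec d → Ξ i → ℝ) (P : ∀ i, Measure (Ξ i))
    (X : ℕ → Ω → Fin n → Vec d) (ξ : ℕ → ∀ i, Ω → Ξ i) (k : ℕ) (ω : Ω) : Stack n d :=
  WithLp.toLp 2 fun i => stochGrad F i (X k ω i) (ξ k i ω) - gradient (localObj F P i) (X k ω i)

/-- The σ-algebra generated by the initial parameters and all samples except for `ξ k i`. -/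
@[reducible] def otherSamples (x₀ : Ω → Fin n → Vec d) (ξ : ℕ → ∀ i, Ω → Ξ i) (k : ℕ) (i : Fin n) :
    MeasurableSpace Ω :=
  MeasurableSpace.comap
    (fun ω => (x₀ ω, fun p : {p : ℕ × Fin n // p ≠ (k, i)} => ξ p.1.1 p.1.2 ω)) inferInstance

variable {x₀ : Ω → Fin n → Vec d} {ξ : ℕ → ∀ i, Ω → Ξ i}

theorem measurable_otherSamples_init (k : ℕ) (i : Fin n) : Measurable[otherSamples x₀ ξ k i] x₀ :=
  measurable_fst.comp (comap_measurable _)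

theorem measurable_otherSamples {k l : ℕ} {i j : Fin n} (h : (l, j) ≠ (k, i)) :
    Measurable[otherSamples x₀ ξ k i] (ξ l j) :=
  (measurable_pi_apply (⟨(l, j), h⟩ : {p : ℕ × Fin n // p ≠ (k, i)})).comp
    (measurable_snd.comp (comap_measurable
      (fun ω => (x₀ ω, fun p : {p : ℕ × Fin n // p ≠ (k, i)} => ξ p.1.1 p.1.2 ω))))

theorem measurable_otherSamples_params (hF : WellPosed F P) {k l : ℕ} (hl : l ≤ k) (i : Fin n) :
    Measurable[otherSamples x₀ ξ k i] (params F τ W α x₀ ξ l) := by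
  refine (@measurable_iter n d Ξ _ F P α τ W Ω (otherSamples x₀ ξ k i) hF x₀ ξ
    (measurable_otherSamples_init k i) l).1 fun m hm j => measurable_otherSamples ?_
  intro h
  have := congrArg Prod.fst h
  simp only at this
  omega

theorem measurable_noise_apply {mΩ : MeasurableSpace Ω} (hF : WellPosed F P) (hf : Smooth F P L)
    {X : ℕ → Ω → Fin n → Vec d} {l : ℕ} {j : Fin n} (hX : Measurable (X l))
    (hξ : Measurable (ξ l j)) : Measurable fun ω => noise F P X ξ l ω j := by
  have h1 : Measurable fun ω => X l ω j := (measurable_pi_apply j).comp hX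
  exact ((hF.measurable_grad j).comp (h1.prodMk hξ)).sub
    ((hf.continuous_gradient j).measurable.comp h1)

theorem measurable_noise {mΩ : MeasurableSpace Ω} (hF : WellPosed F P) (hf : Smooth F P L)
    {X : ℕ → Ω → Fin n → Vec d} {l : ℕ} (hX : Measurable (X l))
    (hξ : ∀ j, Measurable (ξ l j)) : Measurable fun ω => noise F P X ξ l ω :=
  (WithLp.measurable_toLp 2 _).comp
    (measurable_pi_lambda _ fun j => measurable_noise_apply hF hf hX (hξ j))

variable [MeasurableSpace Ω] {μ : Measure Ω} [IsProbabilityMeasure μ]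

omit [IsProbabilityMeasure μ] in
theorem Sampling.measurable_params (hS : Sampling μ P x₀ ξ) (hF : WellPosed F P) (k : ℕ) :
    Measurable (params F τ W α x₀ ξ k) :=
  (measurable_iter hF hS.measurable_init k).1 fun l _ i => hS.measurable l i

omit [IsProbabilityMeasure μ] in
theorem Sampling.otherSamples_le (hS : Sampling μ P x₀ ξ) (k : ℕ) (i : Fin n) :
    otherSamples x₀ ξ k i ≤ ‹MeasurableSpace Ω› :=
  Measurable.comap_le (hS.measurable_init.prodMk
    (measurable_pi_lambda _ fun _ => hS.measurable _ _))

theorem Sampling.indep_otherSamples (hS : Sampling μ P x₀ ξ) (k : ℕ) (i : Fin n) :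
    Indep (otherSamples x₀ ξ k i) (MeasurableSpace.comap (ξ k i) inferInstance) μ := by
  have hV : Measurable fun ω => fun p : {p : ℕ × Fin n // p ≠ (k, i)} => ξ p.1.1 p.1.2 ω :=
    measurable_pi_lambda _ fun _ => hS.measurable _ _
  refine indepFun_prodMk_of_indepFun hS.measurable_init hV (hS.measurable k i) ?_ ?_
  · exact hS.indep_init.comp measurable_id
      (ψ := fun y : (p : ℕ × Fin n) → Ξ p.2 =>
        ((fun p : {p : ℕ × Fin n // p ≠ (k, i)} => y p.1), y (k, i)))
      ((measurable_pi_lambda _ fun p => measurable_pi_apply _).prodMk (measurable_pi_apply _))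
  · have h := indep_iSup_of_disjoint
      (fun p : ℕ × Fin n => (hS.measurable p.1 p.2).comap_le) hS.indep
      (S := ({(k, i)}ᶜ : Set (ℕ × Fin n))) (T := {(k, i)}) disjoint_compl_left
    refine indep_of_indep_of_le_left (indep_of_indep_of_le_right h ?_) ?_
    · exact le_iSup₂_of_le (k, i) rfl le_rfl
    · rw [← measurable_iff_comap_le]
      refine @measurable_pi_lambda _ _ _ (_) _ _ fun p => ?_
      rw [measurable_iff_comap_le]
      exact le_iSup₂_of_le p.1 p.2 le_rfl

variable {X : ℕ → Ω → Fin n → Vec d}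

theorem history_le (hX : ∀ k, Measurable (X k)) (k : ℕ) :
    history X k ≤ ‹MeasurableSpace Ω› :=
  iSup₂_le fun j _ => (hX j).comap_le

theorem GradientNoise.integral_norm_sq_le (hN : GradientNoise μ F P σ X ξ)
    (hX : ∀ k, Measurable (X k)) (k : ℕ) (i : Fin n) :
    ∫ ω, ‖noise F P X ξ k ω i‖ ^ 2 ∂μ ≤ σ ^ 2 := by
  have h := integral_mono_ae integrable_condExp (integrable_const (σ ^ 2)) (hN.variance_le k i)
  rw [integral_condExp (history_le hX k)] at h
  rw [integral_const, probReal_univ, one_smul] at h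
  exact h

omit [IsProbabilityMeasure μ] in
theorem GradientNoise.memLp_noise_apply (hN : GradientNoise μ F P σ X ξ) (hF : WellPosed F P)
    (hf : Smooth F P L) (hX : ∀ k, Measurable (X k)) (hξ : ∀ k i, Measurable (ξ k i))
    (k : ℕ) (i : Fin n) : MemLp (fun ω => noise F P X ξ k ω i) 2 μ :=
  (memLp_two_iff_integrable_sq_norm
    (measurable_noise_apply hF hf (hX k) (hξ k i)).aestronglyMeasurable).2 (hN.sq_integrable k i)

/-- This is where conditional unbiasedness enters: events determined by agent `i`'s current
parameter belong to the history. -/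
theorem GradientNoise.setIntegral_noise_eq_zero (hN : GradientNoise μ F P σ X ξ)
    (hX : ∀ k, Measurable (X k)) (k : ℕ) (i : Fin n)
    (hi : Integrable (fun ω => noise F P X ξ k ω i) μ) {B : Set (Vec d)} (hB : MeasurableSet B) :
    ∫ ω in (fun ω => X k ω i) ⁻¹' B, noise F P X ξ k ω i ∂μ = 0 := by
  have hm := history_le hX k
  have hXk : Measurable[history X k] (X k) :=
    measurable_iff_comap_le.2 (le_iSup₂_of_le k (Set.mem_Iic.2 le_rfl) le_rfl)
  have hB' : MeasurableSet[history X k] ((fun ω => X k ω i) ⁻¹' B) :=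
    ((measurable_pi_apply i).comp hXk) hB
  have hgi : Integrable (fun ω => gradient (localObj F P i) (X k ω i)) μ := by
    refine ((hN.integrable k i).sub hi).congr (Filter.Eventually.of_forall fun ω => ?_)
    simp [noise]
  have h1 := setIntegral_condExp hm (hN.integrable k i) hB'
  rw [setIntegral_congr_ae (hm _ hB') ((hN.unbiased k i).mono fun ω h _ => h)] at h1
  simp only [noise]
  rw [integral_sub (hN.integrable k i).integrableOn hgi.integrableOn, h1, sub_self]

end Noise

/-! ### Orthogonality and variance of accumulated noise -/

section Orthogonality

variable {n d : ℕ} {Ξ : Fin n → Type*} [∀ i, MeasurableSpace (Ξ i)]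
  {F : ∀ i, Vec d → Ξ i → ℝ} {P : ∀ i, Measure (Ξ i)} {L σ α : ℝ} {τ : ℕ}
  {W : ℕ → Matrix (Fin n) (Fin n) ℝ} {Ω : Type*} {x₀ : Ω → Fin n → Vec d}
  {ξ : ℕ → ∀ i, Ω → Ξ i}

theorem norm_stack_sq (v : Stack n d) : ‖v‖ ^ 2 = ∑ i, ‖v i‖ ^ 2 := PiLp.norm_sq_eq_of_L2 _ v

theorem measurable_stack_apply {mΩ : MeasurableSpace Ω} {v : Ω → Stack n d} (hv : Measurable v)
    (i : Fin n) : Measurable fun ω => v ω i :=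
  (measurable_pi_apply i).comp ((WithLp.measurable_ofLp 2 _).comp hv)

variable [MeasurableSpace Ω] {μ : Measure Ω}

theorem memLp_stack_apply {v : Ω → Stack n d} (hv : Measurable v) (h : MemLp v 2 μ) (i : Fin n) :
    MemLp (fun ω => v ω i) 2 μ :=
  h.mono (measurable_stack_apply hv i).aestronglyMeasurable
    (Filter.Eventually.of_forall fun ω => PiLp.norm_apply_le (v ω) i)

theorem memLp_stack {v : Ω → Stack n d} (hv : Measurable v)
    (h : ∀ i, MemLp (fun ω => v ω i) 2 μ) : MemLp v 2 μ := by
  refine (memLp_two_iff_integrable_sq_norm hv.aestronglyMeasurable).2 ?_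
  simp_rw [norm_stack_sq]
  exact integrable_finsetSum _ fun i _ => (h i).integrable_norm_pow two_ne_zero

theorem memLp_linearMap {E : Type*} [NormedAddCommGroup E] [NormedSpace ℝ E]
    [FiniteDimensional ℝ E] {v : Ω → E} (M : E →ₗ[ℝ] E) (h : MemLp v 2 μ) :
    MemLp (fun ω => M (v ω)) 2 μ :=
  (LinearMap.toContinuousLinearMap M).comp_memLp' h

theorem measurable_linearMap {E : Type*} [NormedAddCommGroup E] [NormedSpace ℝ E]
    [FiniteDimensional ℝ E] [MeasurableSpace E] [BorelSpace E] (M : E →ₗ[ℝ] E) : Measurable M :=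
  M.continuous_of_finiteDimensional.measurable

theorem integrable_inner_of_memLp {V : Type*} [NormedAddCommGroup V] [InnerProductSpace ℝ V]
    {u v : Ω → V} (hu : MemLp u 2 μ) (hv : MemLp v 2 μ) :
    Integrable (fun ω => inner ℝ (u ω) (v ω)) μ := by
  refine (hu.norm.integrable_mul hv.norm).mono
    (hu.aestronglyMeasurable.inner hv.aestronglyMeasurable)
    (Filter.Eventually.of_forall fun ω => ?_)
  simpa using norm_inner_le_norm (𝕜 := ℝ) (u ω) (v ω)

theorem integral_norm_add_sq {V : Type*} [NormedAddCommGroup V] [InnerProductSpace ℝ V]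
    {u v : Ω → V} (hu : MemLp u 2 μ) (hv : MemLp v 2 μ) :
    ∫ ω, ‖u ω + v ω‖ ^ 2 ∂μ
      = ∫ ω, ‖u ω‖ ^ 2 ∂μ + 2 * ∫ ω, inner ℝ (u ω) (v ω) ∂μ + ∫ ω, ‖v ω‖ ^ 2 ∂μ := by
  have h1 := hu.integrable_norm_pow two_ne_zero
  have h2 := (integrable_inner_of_memLp hu hv).const_mul 2
  simp_rw [norm_add_sq_real]
  rw [integral_add, integral_add, integral_const_mul]
  · exact h1
  · exact h2
  · exact h1.add h2
  · exact hv.integrable_norm_pow two_ne_zero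

variable [IsProbabilityMeasure μ]

omit [IsProbabilityMeasure μ] in
theorem GradientNoise.memLp_noise {X : ℕ → Ω → Fin n → Vec d} (hN : GradientNoise μ F P σ X ξ)
    (hF : WellPosed F P) (hf : Smooth F P L) (hX : ∀ k, Measurable (X k))
    (hξ : ∀ k i, Measurable (ξ k i)) (k : ℕ) : MemLp (noise F P X ξ k) 2 μ :=
  memLp_stack (measurable_noise hF hf (hX k) (hξ k)) fun i => hN.memLp_noise_apply hF hf hX hξ k i

/-- Here `u` may involve earlier noises and the simultaneous noise of other agents, neither of which
need be measurable for the history. -/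
theorem integral_inner_noise_apply_eq_zero (hF : WellPosed F P) (hf : Smooth F P L)
    (hS : Sampling μ P x₀ ξ) (hN : GradientNoise μ F P σ (params F τ W α x₀ ξ) ξ) (k : ℕ)
    (i : Fin n) {u : Ω → Vec d} (hu : Measurable[otherSamples x₀ ξ k i] u) (hu2 : MemLp u 2 μ) :
    ∫ ω, inner ℝ (u ω) (noise F P (params F τ W α x₀ ξ) ξ k ω i) ∂μ = 0 := by
  have hs := hN.memLp_noise_apply hF hf (hS.measurable_params hF) hS.measurable k i
  have hi := hs.integrable one_le_two
  have hφ : Measurable fun p : Vec d × Ξ i =>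
      stochGrad F i p.1 p.2 - gradient (localObj F P i) p.1 :=
    (hF.measurable_grad i).sub ((hf.continuous_gradient i).measurable.comp measurable_fst)
  exact integral_inner_eq_zero_of_indep (hS.otherSamples_le k i) (hS.measurable k i)
    (hS.indep_otherSamples k i)
    ((measurable_pi_apply i).comp (measurable_otherSamples_params hF le_rfl i)) hu hφ hi
    (integrable_inner_of_memLp hu2 hs)
    fun B hB => hN.setIntegral_noise_eq_zero (hS.measurable_params hF) k i hi hB

theorem integral_inner_noise_eq_zero (hF : WellPosed F P) (hf : Smooth F P L)
    (hS : Sampling μ P x₀ ξ) (hN : GradientNoise μ F P σ (params F τ W α x₀ ξ) ξ) (k : ℕ)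
    {u : Ω → Stack n d} (hu : ∀ i, Measurable[otherSamples x₀ ξ k i] u) (hu' : Measurable u)
    (hu2 : MemLp u 2 μ) :
    ∫ ω, inner ℝ (u ω) (noise F P (params F τ W α x₀ ξ) ξ k ω) ∂μ = 0 := by
  simp_rw [PiLp.inner_apply]
  rw [integral_finsetSum]
  · exact Finset.sum_eq_zero fun i _ => integral_inner_noise_apply_eq_zero hF hf hS hN k i
      (measurable_stack_apply (hu i) i) (memLp_stack_apply hu' hu2 i)
  · exact fun i _ => integrable_inner_of_memLp (memLp_stack_apply hu' hu2 i)
      (hN.memLp_noise_apply hF hf (hS.measurable_params hF) hS.measurable k i)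

theorem integral_inner_avg_noise_eq_zero (hF : WellPosed F P) (hf : Smooth F P L)
    (hS : Sampling μ P x₀ ξ) (hN : GradientNoise μ F P σ (params F τ W α x₀ ξ) ξ) (k : ℕ)
    {u : Ω → Vec d} (hu : ∀ i, Measurable[otherSamples x₀ ξ k i] u) (hu2 : MemLp u 2 μ) :
    ∫ ω, inner ℝ (u ω) (avg fun i => noise F P (params F τ W α x₀ ξ) ξ k ω i) ∂μ = 0 := by
  simp_rw [avg, real_inner_smul_right, inner_sum]
  rw [integral_const_mul, integral_finsetSum]
  · rw [Finset.sum_eq_zero fun i _ => integral_inner_noise_apply_eq_zero hF hf hS hN k i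
      (hu i) hu2, mul_zero]
  · exact fun i _ => integrable_inner_of_memLp hu2
      (hN.memLp_noise_apply hF hf (hS.measurable_params hF) hS.measurable k i)

/-- Cross terms between agents vanish, so averaging divides the variance by `n`. -/
theorem integral_norm_avg_noise_sq_le (hn : 1 ≤ n) (hF : WellPosed F P) (hf : Smooth F P L)
    (hS : Sampling μ P x₀ ξ) (hN : GradientNoise μ F P σ (params F τ W α x₀ ξ) ξ) (k : ℕ) :
    ∫ ω, ‖avg fun i => noise F P (params F τ W α x₀ ξ) ξ k ω i‖ ^ 2 ∂μ ≤ σ ^ 2 / n := by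
  have hn' : (0 : ℝ) < n := by exact_mod_cast hn
  have hX := hS.measurable_params (τ := τ) (W := W) (α := α) hF
  have hL2 := hN.memLp_noise_apply hF hf hX hS.measurable k
  have hcross : ∀ i j, i ≠ j → ∫ ω, inner ℝ (noise F P (params F τ W α x₀ ξ) ξ k ω i)
      (noise F P (params F τ W α x₀ ξ) ξ k ω j) ∂μ = 0 := by
    intro i j hij
    refine integral_inner_noise_apply_eq_zero hF hf hS hN k j ?_ (hL2 i)
    refine measurable_noise_apply hF hf (measurable_otherSamples_params hF le_rfl j)
      (measurable_otherSamples fun h => hij (congrArg Prod.snd h))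
  have hexp : ∀ ω, ‖avg fun i => noise F P (params F τ W α x₀ ξ) ξ k ω i‖ ^ 2
      = (1 / (n : ℝ)) ^ 2 * ∑ i, ∑ j, inner ℝ (noise F P (params F τ W α x₀ ξ) ξ k ω i)
        (noise F P (params F τ W α x₀ ξ) ξ k ω j) := by
    intro ω
    rw [avg, norm_smul, mul_pow, Real.norm_of_nonneg (by positivity),
      ← real_inner_self_eq_norm_sq, sum_inner]
    simp_rw [inner_sum]
  simp_rw [hexp]
  rw [integral_const_mul, integral_finsetSum _ fun i _ => integrable_finsetSum _ fun j _ =>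
    integrable_inner_of_memLp (hL2 i) (hL2 j)]
  have hdiag : ∀ i ∈ Finset.univ, ∫ ω, ∑ j, inner ℝ (noise F P (params F τ W α x₀ ξ) ξ k ω i)
      (noise F P (params F τ W α x₀ ξ) ξ k ω j) ∂μ ≤ σ ^ 2 := by
    intro i _
    rw [integral_finsetSum _ fun j _ => integrable_inner_of_memLp (hL2 i) (hL2 j),
      Finset.sum_eq_single i (fun j _ hj => hcross i j hj.symm) (by simp)]
    simp_rw [real_inner_self_eq_norm_sq]
    exact hN.integral_norm_sq_le hX k i
  calc _ ≤ (1 / (n : ℝ)) ^ 2 * ∑ _i : Fin n, σ ^ 2 := by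
        gcongr with i
        exact hdiag i (Finset.mem_univ i)
    _ = _ := by simp; field_simp

theorem integral_norm_sum_noise_sq_eq (hF : WellPosed F P) (hf : Smooth F P L)
    (hS : Sampling μ P x₀ ξ) (hN : GradientNoise μ F P σ (params F τ W α x₀ ξ) ξ)
    (M : ℕ → Stack n d →ₗ[ℝ] Stack n d) (m : ℕ) :
    ∫ ω, ‖∑ p ∈ Finset.range m, M p (noise F P (params F τ W α x₀ ξ) ξ p ω)‖ ^ 2 ∂μ
      = ∑ p ∈ Finset.range m, ∫ ω, ‖M p (noise F P (params F τ W α x₀ ξ) ξ p ω)‖ ^ 2 ∂μ := by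
  have hX := hS.measurable_params (τ := τ) (W := W) (α := α) hF
  have hL2 := fun k => memLp_linearMap (M k) (hN.memLp_noise hF hf hX hS.measurable k)
  have hM : ∀ T : Stack n d →ₗ[ℝ] Stack n d, Measurable T := measurable_linearMap
  induction m with
  | zero => simp
  | succ m ih =>
    have hsum : MemLp (fun ω => ∑ p ∈ Finset.range m,
        M p (noise F P (params F τ W α x₀ ξ) ξ p ω)) 2 μ := memLp_finsetSum _ fun p _ => hL2 p
    have hmeas : Measurable fun ω => ∑ p ∈ Finset.range m,
        M p (noise F P (params F τ W α x₀ ξ) ξ p ω) :=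
      Finset.measurable_fun_sum _ fun p _ =>
        (hM _).comp (measurable_noise hF hf (hX p) (hS.measurable p))
    have hmeas' : ∀ i, Measurable[otherSamples x₀ ξ m i] fun ω => ∑ p ∈ Finset.range m,
        M p (noise F P (params F τ W α x₀ ξ) ξ p ω) := fun i =>
      Finset.measurable_fun_sum _ fun p hp =>
        (hM _).comp (measurable_noise hF hf
          (measurable_otherSamples_params hF (Finset.mem_range.1 hp).le i) fun j =>
            measurable_otherSamples fun h =>
              (Finset.mem_range.1 hp).ne (congrArg Prod.fst h))
    -- The adjoint moves `M m` off the newest noise, leaving it paired with a function of earlier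
    -- samples.
    have h0 := integral_inner_noise_eq_zero hF hf hS hN m
      (u := fun ω => LinearMap.adjoint (M m) (∑ p ∈ Finset.range m,
        M p (noise F P (params F τ W α x₀ ξ) ξ p ω)))
      (fun i => (hM _).comp (hmeas' i)) ((hM _).comp hmeas) (memLp_linearMap _ hsum)
    simp_rw [LinearMap.adjoint_inner_left] at h0
    simp_rw [Finset.sum_range_succ]
    rw [integral_norm_add_sq hsum (hL2 m), h0, ih, mul_zero, add_zero]

theorem integral_norm_noise_sq_le {X : ℕ → Ω → Fin n → Vec d} (hF : WellPosed F P)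
    (hf : Smooth F P L) (hN : GradientNoise μ F P σ X ξ) (hX : ∀ k, Measurable (X k))
    (hξ : ∀ k i, Measurable (ξ k i)) (k : ℕ) :
    ∫ ω, ‖noise F P X ξ k ω‖ ^ 2 ∂μ ≤ n * σ ^ 2 := by
  simp_rw [norm_stack_sq]
  rw [integral_finsetSum _ fun i _ =>
    (hN.memLp_noise_apply hF hf hX hξ k i).integrable_norm_pow two_ne_zero]
  calc _ ≤ ∑ _i : Fin n, σ ^ 2 := Finset.sum_le_sum fun i _ => hN.integral_norm_sq_le hX k i
    _ = _ := by simp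

theorem integral_norm_sum_noiseGain_sq_le (hn : 1 ≤ n) (hW : FiniteTimeConsensus τ W)
    (hF : WellPosed F P) (hf : Smooth F P L)
    (hS : Sampling μ P x₀ ξ) (hN : GradientNoise μ F P σ (params F τ W α x₀ ξ) ξ) (k : ℕ) :
    ∫ ω, ‖∑ p ∈ Finset.range k, noiseGain (cyclicMixing d τ W) (deviation n d) k p
        (noise F P (params F τ W α x₀ ξ) ξ p ω)‖ ^ 2 ∂μ ≤ 32 * (τ : ℝ) ^ 3 * (n * σ ^ 2) := by
  have hX := hS.measurable_params (τ := τ) (W := W) (α := α) hF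
  rw [integral_norm_sum_noise_sq_eq hF hf hS hN]
  have hA : ∀ k (v : Stack n d), ‖cyclicMixing d τ W k v‖ ≤ ‖v‖ := fun k v =>
    norm_mixing_le (hW.mod_mem k) v
  have hQ : ∀ v, ‖deviation n d v‖ ≤ ‖v‖ := fun v =>
    pow_le_pow_iff_left₀ (norm_nonneg _) (norm_nonneg _) two_ne_zero |>.1 (by
      rw [norm_sq_eq_deviation_add_consensus hn v]; exact le_add_of_nonneg_right (sq_nonneg _))
  have hterm : ∀ p ∈ Finset.range k,
      ∫ ω, ‖noiseGain (cyclicMixing d τ W) (deviation n d) k p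
        (noise F P (params F τ W α x₀ ξ) ξ p ω)‖ ^ 2 ∂μ
      ≤ if k ≤ p + 2 * τ then 16 * (τ : ℝ) ^ 2 * (n * σ ^ 2) else 0 := by
    intro p hp
    split_ifs with h
    · have hi := hN.memLp_noise hF hf hX hS.measurable p
      calc _ ≤ ∫ ω, 16 * (τ : ℝ) ^ 2 * ‖noise F P (params F τ W α x₀ ξ) ξ p ω‖ ^ 2 ∂μ := by
            refine integral_mono ((memLp_linearMap _ hi).integrable_norm_pow two_ne_zero)
              ((hi.integrable_norm_pow two_ne_zero).const_mul _) fun ω => ?_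
            refine (pow_le_pow_left₀ (norm_nonneg _)
              (norm_noiseGain_le hA hQ (Finset.mem_range.1 hp) h _) 2).trans (le_of_eq ?_)
            ring
        _ ≤ _ := by
            rw [integral_const_mul]
            exact mul_le_mul_of_nonneg_left
              (integral_norm_noise_sq_le hF hf hN hX hS.measurable p) (by positivity)
    · rw [noiseGain_eq_zero (fun k p hk => transition_eq_zero hW hn hk) (by omega)]
      simp
  refine (Finset.sum_le_sum hterm).trans ?_
  rw [← Finset.sum_filter, Finset.sum_const, nsmul_eq_mul]
  -- Only the last `2 * τ` noises have a nonzero gain.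
  have hcard : ((Finset.range k).filter fun p => k ≤ p + 2 * τ).card ≤ 2 * τ := by
    refine (Finset.card_le_card (t := Finset.Ico (k - 2 * τ) k) fun p hp => ?_).trans
      (by rw [Nat.card_Ico]; omega)
    have h1 := (Finset.mem_filter.1 hp).2
    have h2 := Finset.mem_range.1 (Finset.mem_filter.1 hp).1
    exact Finset.mem_Ico.2 ⟨by omega, h2⟩
  have hcard' : ((((Finset.range k).filter fun p => k ≤ p + 2 * τ).card : ℕ) : ℝ) ≤ 2 * τ := by
    exact_mod_cast hcard
  calc _ ≤ (2 * (τ : ℝ)) * (16 * (τ : ℝ) ^ 2 * (n * σ ^ 2)) := by gcongr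
    _ = _ := by ring

end Orthogonality

/-! ### The algorithm as an instance of the abstract recursion -/

section Dynamics

variable {n d : ℕ} {Ξ : Fin n → Type*} [∀ i, MeasurableSpace (Ξ i)]
  {F : ∀ i, Vec d → Ξ i → ℝ} {P : ∀ i, Measure (Ξ i)} {L σ α B : ℝ} {τ : ℕ}
  {W : ℕ → Matrix (Fin n) (Fin n) ℝ} {Ω : Type*} {x₀ : Ω → Fin n → Vec d}
  {ξ : ℕ → ∀ i, Ω → Ξ i}

/-- The random tracking variables `g^(k)` of all agents. -/
noncomputable def trackers (F : ∀ i, Vec d → Ξ i → ℝ) (τ : ℕ) (W : ℕ → Matrix (Fin n) (Fin n) ℝ)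
    (α : ℝ) (x₀ : Ω → Fin n → Vec d) (ξ : ℕ → ∀ i, Ω → Ξ i) (k : ℕ) (ω : Ω) : Fin n → Vec d :=
  (iter F τ W α (x₀ ω) (fun k i => ξ k i ω) k).2

/-- The exact local gradients at the agents' points. -/
noncomputable def localGrads (F : ∀ i, Vec d → Ξ i → ℝ) (P : ∀ i, Measure (Ξ i))
    (x : Fin n → Vec d) : Stack n d :=
  WithLp.toLp 2 fun i => gradient (localObj F P i) (x i)

omit [∀ i, MeasurableSpace (Ξ i)] in
theorem stack_params_succ (k : ℕ) (ω : Ω) :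
    (WithLp.toLp 2 (params F τ W α x₀ ξ (k + 1) ω) : Stack n d)
      = cyclicMixing d τ W k (WithLp.toLp 2 (params F τ W α x₀ ξ k ω)
        - α • WithLp.toLp 2 (trackers F τ W α x₀ ξ k ω)) := rfl

theorem localGrads_add_noise (X : ℕ → Ω → Fin n → Vec d) (k : ℕ) (ω : Ω) :
    localGrads F P (X k ω) + noise F P X ξ k ω
      = WithLp.toLp 2 fun i => stochGrad F i (X k ω i) (ξ k i ω) := by
  ext1 i
  simp [localGrads, noise]

theorem stack_trackers_zero (ω : Ω) :
    (WithLp.toLp 2 (trackers F τ W α x₀ ξ 0 ω) : Stack n d)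
      = localGrads F P (params F τ W α x₀ ξ 0 ω) + noise F P (params F τ W α x₀ ξ) ξ 0 ω := by
  rw [localGrads_add_noise]; rfl

theorem stack_trackers_succ (k : ℕ) (ω : Ω) :
    (WithLp.toLp 2 (trackers F τ W α x₀ ξ (k + 1) ω) : Stack n d)
      = cyclicMixing d τ W k (WithLp.toLp 2 (trackers F τ W α x₀ ξ k ω))
        + (localGrads F P (params F τ W α x₀ ξ (k + 1) ω)
          + noise F P (params F τ W α x₀ ξ) ξ (k + 1) ω)
        - (localGrads F P (params F τ W α x₀ ξ k ω)
          + noise F P (params F τ W α x₀ ξ) ξ k ω) := by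
  rw [localGrads_add_noise, localGrads_add_noise]; rfl

theorem Smooth.norm_localGrads_sub_le (hf : Smooth F P L) (x y : Fin n → Vec d) :
    ‖localGrads F P x - localGrads F P y‖
      ≤ L * ‖(WithLp.toLp 2 x : Stack n d) - WithLp.toLp 2 y‖ := by
  refine pow_le_pow_iff_left₀ (norm_nonneg _) (mul_nonneg hf.pos.le (norm_nonneg _))
    two_ne_zero |>.1 ?_
  rw [mul_pow, norm_stack_sq, norm_stack_sq, Finset.mul_sum]
  refine Finset.sum_le_sum fun i _ => ?_
  rw [← mul_pow]
  exact pow_le_pow_left₀ (norm_nonneg _) (hf.lipschitz i _ _) 2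

/-- Unit column sums make mixing invisible to averages, and the average tracker equals the average
stochastic gradient. -/
theorem avg_params_succ (hn : 1 ≤ n) (hW : FiniteTimeConsensus τ W) (k : ℕ) (ω : Ω) :
    avg (params F τ W α x₀ ξ (k + 1) ω) = avg (params F τ W α x₀ ξ k ω)
      - α • (avgGrad F P (params F τ W α x₀ ξ k ω)
        + avg fun i => noise F P (params F τ W α x₀ ξ) ξ k ω i) := by
  have hJA : ∀ k (v : Stack n d), consensus n d (cyclicMixing d τ W k v) = consensus n d v :=
    fun k v => consensus_mixing (hW.mod_mem k) v
  have h1 := consensus_tracker (g := fun k => WithLp.toLp 2 (trackers F τ W α x₀ ξ k ω))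
    (H := fun k => localGrads F P (params F τ W α x₀ ξ k ω))
    (s := fun k => noise F P (params F τ W α x₀ ξ) ξ k ω) hJA
    (stack_trackers_zero ω) (fun k => stack_trackers_succ k ω) k
  have h2 := congrArg (fun v => consensus n d v ⟨0, hn⟩)
    (stack_params_succ (F := F) (τ := τ) (W := W) (α := α) (x₀ := x₀) (ξ := ξ) k ω)
  simp only [hJA, map_sub, map_smul, h1, map_add, PiLp.sub_apply, PiLp.smul_apply,
    PiLp.add_apply, consensus_apply] at h2
  exact h2

/-- The accumulated consensus error of a trajectory. -/
theorem sum_deviation_params_sq_le (hn : 1 ≤ n) (hW : FiniteTimeConsensus τ W)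
    (hf : Smooth F P L) (hα : 48 * α ^ 2 * (τ : ℝ) ^ 4 * L ^ 2 ≤ 1) (T : ℕ) (ω : Ω) :
    ∑ k ∈ Finset.range (T + 1), ‖deviation n d (WithLp.toLp 2 (params F τ W α x₀ ξ k ω))‖ ^ 2
      ≤ 24 * τ * (‖deviation n d (WithLp.toLp 2 (x₀ ω))‖ ^ 2
          + α ^ 2 * (τ : ℝ) ^ 2 * ‖deviation n d (localGrads F P (x₀ ω))‖ ^ 2)
        + 12 * α ^ 2 * ∑ k ∈ Finset.range (T + 1),
            ‖∑ p ∈ Finset.range k, noiseGain (cyclicMixing d τ W) (deviation n d) k p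
              (noise F P (params F τ W α x₀ ξ) ξ p ω)‖ ^ 2
        + α ^ 2 / 2 * ∑ k ∈ Finset.range (T + 1), n * ‖avgGrad F P (params F τ W α x₀ ξ k ω)
            + avg fun i => noise F P (params F τ W α x₀ ξ) ξ k ω i‖ ^ 2 := by
  have h := sum_deviation_sq_le (J := consensus n d)
    (x := fun k => WithLp.toLp 2 (params F τ W α x₀ ξ k ω))
    (g := fun k => WithLp.toLp 2 (trackers F τ W α x₀ ξ k ω))
    (H := fun k => localGrads F P (params F τ W α x₀ ξ k ω))
    (s := fun k => noise F P (params F τ W α x₀ ξ) ξ k ω)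
    (fun k v => norm_mixing_le (hW.mod_mem k) v) (fun k v => deviation_mixing (hW.mod_mem k) v)
    (fun k v => consensus_mixing (hW.mod_mem k) v) (norm_sq_eq_deviation_add_consensus hn)
    (fun k p hk => transition_eq_zero hW hn hk) (fun k hk => transition_zero_eq_zero hW hn hk)
    (stack_trackers_zero ω) (fun k => stack_trackers_succ k ω) (fun k => stack_params_succ k ω)
    (fun k => hf.norm_localGrads_sub_le _ _) hα T
  refine h.trans (le_of_eq ?_)
  congr 2
  refine Finset.sum_congr rfl fun k _ => ?_
  rw [norm_consensus_sq]
  simp only [PiLp.add_apply, avg_add]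
  rfl

end Dynamics

/-! ### Square integrability along the trajectory -/

section Integrability

variable {n d : ℕ} {Ξ : Fin n → Type*} [∀ i, MeasurableSpace (Ξ i)]
  {F : ∀ i, Vec d → Ξ i → ℝ} {P : ∀ i, Measure (Ξ i)} {L σ α B : ℝ} {τ : ℕ}
  {W : ℕ → Matrix (Fin n) (Fin n) ℝ} {Ω : Type*} {x₀ : Ω → Fin n → Vec d}
  {ξ : ℕ → ∀ i, Ω → Ξ i} [MeasurableSpace Ω] {μ : Measure Ω}

theorem measurable_avg {Ω : Type*} {mΩ : MeasurableSpace Ω} {u : Ω → Fin n → Vec d}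
    (hu : Measurable u) : Measurable fun ω => avg (u ω) := by
  have h : Measurable fun ω => ∑ i, u ω i :=
    Finset.measurable_fun_sum _ fun i _ => (measurable_pi_apply i).comp hu
  exact h.const_smul (1 / (n : ℝ))

theorem memLp_avg {u : Ω → Fin n → Vec d} (hu : ∀ i, MemLp (fun ω => u ω i) 2 μ) :
    MemLp (fun ω => avg (u ω)) 2 μ :=
  (memLp_finsetSum Finset.univ fun i _ => hu i).const_smul (1 / (n : ℝ))

theorem Smooth.measurable_localGrads {Ω : Type*} {mΩ : MeasurableSpace Ω} (hf : Smooth F P L)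
    {u : Ω → Fin n → Vec d}
    (hu : Measurable u) : Measurable fun ω => localGrads F P (u ω) :=
  (WithLp.measurable_toLp 2 _).comp (measurable_pi_lambda _ fun i =>
    (hf.continuous_gradient i).measurable.comp ((measurable_pi_apply i).comp hu))

theorem Smooth.measurable_avgGrad {Ω : Type*} {mΩ : MeasurableSpace Ω} (hf : Smooth F P L)
    {u : Ω → Fin n → Vec d}
    (hu : Measurable u) : Measurable fun ω => avgGrad F P (u ω) :=
  measurable_avg (measurable_pi_lambda _ fun i =>
    (hf.continuous_gradient i).measurable.comp ((measurable_pi_apply i).comp hu))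

theorem Smooth.memLp_gradient_sub (hf : Smooth F P L) (i : Fin n) {u v : Ω → Vec d}
    (hu : Measurable u) (hv : Measurable v) (h : MemLp (fun ω => u ω - v ω) 2 μ) :
    MemLp (fun ω => gradient (localObj F P i) (u ω) - gradient (localObj F P i) (v ω)) 2 μ :=
  h.of_le_mul (c := L) (((hf.continuous_gradient i).measurable.comp hu).sub
    ((hf.continuous_gradient i).measurable.comp hv)).aestronglyMeasurable
    (Filter.Eventually.of_forall fun _ => hf.lipschitz i _ _)

theorem Smooth.memLp_gradient_objective (hf : Smooth F P L) (hn : 1 ≤ n) [IsFiniteMeasure μ]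
    {u : Ω → Vec d} (hu : Measurable u) (h : Integrable (fun ω => objective F P (u ω)) μ) :
    MemLp (fun ω => gradient (objective F P) (u ω)) 2 μ := by
  have hm := hf.continuous_gradient_objective.measurable.comp hu
  refine (memLp_two_iff_integrable_sq_norm hm.aestronglyMeasurable).2 ?_
  refine ((h.sub (integrable_const (optValue F P))).const_mul (2 * L)).mono'
    (hm.norm.pow_const 2).aestronglyMeasurable (Filter.Eventually.of_forall fun ω => ?_)
  rw [Real.norm_of_nonneg (sq_nonneg _)]
  exact hf.norm_gradient_objective_sq_le hn (u ω)

theorem InitialDataBound.memLp_deviation (hI : InitialDataBound μ F P L B x₀)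
    (hx₀ : Measurable x₀) (i : Fin n) : MemLp (fun ω => x₀ ω i - avg (x₀ ω)) 2 μ :=
  (memLp_two_iff_integrable_sq_norm (((measurable_pi_apply i).comp hx₀).sub
    (measurable_avg hx₀)).aestronglyMeasurable).2 (hI.integrable_consensus i)

/-- Heterogeneity and consensus control the difference between `∇f_i` and `∇f` at the average, and
`‖∇f‖² ≤ 2L (f - f^*)` is integrable. -/
theorem InitialDataBound.memLp_gradient_avg (hI : InitialDataBound μ F P L B x₀) (hn : 1 ≤ n)
    [IsFiniteMeasure μ] (hf : Smooth F P L) (hx₀ : Measurable x₀) (i : Fin n) :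
    MemLp (fun ω => gradient (localObj F P i) (avg (x₀ ω))) 2 μ := by
  have hxi : ∀ j, Measurable fun ω => x₀ ω j := fun j => (measurable_pi_apply j).comp hx₀
  have hav := measurable_avg hx₀
  have h1 := fun j => hf.memLp_gradient_sub j (hxi j) hav (hI.memLp_deviation hx₀ j)
  have h2 : MemLp (fun ω => gradient (localObj F P i) (x₀ ω i) - avgGrad F P (x₀ ω)) 2 μ :=
    (memLp_two_iff_integrable_sq_norm (((hf.continuous_gradient i).measurable.comp (hxi i)).sub
      (hf.measurable_avgGrad hx₀)).aestronglyMeasurable).2 (hI.integrable_heterogeneity i)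
  have h3 := memLp_avg h1
  have h4 := hf.memLp_gradient_objective hn hav hI.integrable_obj
  refine (((h2.sub (h1 i)).add h3).add h4).ae_eq (Filter.Eventually.of_forall fun ω => ?_)
  simp only [Pi.add_apply, Pi.sub_apply, avg_sub, hf.gradient_objective, avgGrad]
  abel

variable [IsProbabilityMeasure μ]

theorem memLp_localGrads (hn : 1 ≤ n) (hf : Smooth F P L)
    (hI : InitialDataBound μ F P L B x₀) (hx₀ : Measurable x₀) {u : Ω → Fin n → Vec d}
    (hu : Measurable u) (h : ∀ i, MemLp (fun ω => u ω i - avg (x₀ ω)) 2 μ) :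
    MemLp (fun ω => localGrads F P (u ω)) 2 μ := by
  refine memLp_stack (hf.measurable_localGrads hu) fun i => ?_
  refine ((hf.memLp_gradient_sub i ((measurable_pi_apply i).comp hu) (measurable_avg hx₀)
    (h i)).add (hI.memLp_gradient_avg hn hf hx₀ i)).ae_eq
      (Filter.Eventually.of_forall fun ω => ?_)
  simp [localGrads]

/-- Parameters are measured relative to the initial average, because `x₀` itself need not be square
integrable. Unit row sums carry this reference point through the mixing. -/
theorem memLp_iter (hn : 1 ≤ n) (hW : FiniteTimeConsensus τ W) (hF : WellPosed F P)
    (hf : Smooth F P L) (hS : Sampling μ P x₀ ξ) (hI : InitialDataBound μ F P L B x₀)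
    (hN : GradientNoise μ F P σ (params F τ W α x₀ ξ) ξ) (k : ℕ) :
    (∀ i, MemLp (fun ω => params F τ W α x₀ ξ k ω i - avg (x₀ ω)) 2 μ) ∧
      MemLp (fun ω => (WithLp.toLp 2 (trackers F τ W α x₀ ξ k ω) : Stack n d)) 2 μ := by
  have hX := hS.measurable_params (τ := τ) (W := W) (α := α) hF
  have hg : ∀ k i, Measurable fun ω => trackers F τ W α x₀ ξ k ω i := fun k i =>
    (measurable_pi_apply i).comp
      ((measurable_iter hF hS.measurable_init k).2 fun l _ j => hS.measurable l j)
  have hgS : ∀ k, Measurable fun ω =>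
      (WithLp.toLp 2 (trackers F τ W α x₀ ξ k ω) : Stack n d) := fun k =>
    (WithLp.measurable_toLp 2 _).comp (measurable_pi_lambda _ fun i => hg k i)
  have hs := fun k => hN.memLp_noise hF hf hX hS.measurable k
  have hG := fun k h =>
    (memLp_localGrads hn hf hI hS.measurable_init (hX k) h).add (hs k)
  induction k with
  | zero =>
    have h0 : ∀ i, MemLp (fun ω => params F τ W α x₀ ξ 0 ω i - avg (x₀ ω)) 2 μ :=
      hI.memLp_deviation hS.measurable_init
    refine ⟨h0, (hG 0 h0).ae_eq (Filter.Eventually.of_forall fun ω => ?_)⟩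
    exact (stack_trackers_zero ω).symm
  | succ k ih =>
    obtain ⟨hx, hgk⟩ := ih
    have hx' : ∀ i, MemLp (fun ω => params F τ W α x₀ ξ (k + 1) ω i - avg (x₀ ω)) 2 μ := by
      intro i
      obtain ⟨-, hrow, -⟩ := mem_doublyStochastic_iff_sum.1 (hW.mod_mem k)
      refine (memLp_finsetSum Finset.univ fun j _ => ((hx j).sub
        ((memLp_stack_apply (hgS k) hgk j).const_smul α)).const_smul (W (k % τ) i j)).ae_eq
          (Filter.Eventually.of_forall fun ω => ?_)
      have : avg (x₀ ω) = ∑ j, W (k % τ) i j • avg (x₀ ω) := by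
        rw [← Finset.sum_smul, hrow, one_smul]
      change ∑ j, W (k % τ) i j • ((params F τ W α x₀ ξ k ω j - avg (x₀ ω))
          - α • trackers F τ W α x₀ ξ k ω j)
        = (∑ j, W (k % τ) i j • (params F τ W α x₀ ξ k ω j - α • trackers F τ W α x₀ ξ k ω j))
          - avg (x₀ ω)
      conv_rhs => rw [this]
      rw [← Finset.sum_sub_distrib]
      refine Finset.sum_congr rfl fun j _ => ?_
      module
    refine ⟨hx', (((memLp_linearMap (cyclicMixing d τ W k) hgk).add (hG (k + 1) hx')).sub
      (hG k hx)).ae_eq (Filter.Eventually.of_forall fun ω => ?_)⟩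
    exact (stack_trackers_succ k ω).symm

end Integrability

/-! ### Expected descent, expected deviation and the bound for a general stepsize -/

section Expectation

variable {n d : ℕ} {Ξ : Fin n → Type*} [∀ i, MeasurableSpace (Ξ i)]
  {F : ∀ i, Vec d → Ξ i → ℝ} {P : ∀ i, Measure (Ξ i)} {L σ α B : ℝ} {τ : ℕ}
  {W : ℕ → Matrix (Fin n) (Fin n) ℝ} {Ω : Type*} {x₀ : Ω → Fin n → Vec d}
  {ξ : ℕ → ∀ i, Ω → Ξ i} [MeasurableSpace Ω] {μ : Measure Ω} [IsProbabilityMeasure μ]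

omit [IsProbabilityMeasure μ] in
theorem InitialDataBound.nonneg (hI : InitialDataBound μ F P L B x₀) : 0 ≤ B :=
  le_trans (mul_nonneg (by positivity) (Finset.sum_nonneg fun _ _ =>
    integral_nonneg fun _ => sq_nonneg _)) hI.consensus

/-- The objective at `u` lies between its infimum and the quadratic upper bound centred at `v`. -/
theorem Smooth.integrable_objective_of_memLp_sub (hf : Smooth F P L) (hn : 1 ≤ n)
    {u v : Ω → Vec d} (hu : Measurable u) (hv : Measurable v)
    (h : Integrable (fun ω => objective F P (v ω)) μ) (huv : MemLp (fun ω => u ω - v ω) 2 μ) :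
    Integrable (fun ω => objective F P (u ω)) μ := by
  have hgrad := hf.memLp_gradient_objective hn hv h
  refine integrable_of_le_of_le
    (hf.continuous_objective.measurable.comp hu).aestronglyMeasurable
    (g₁ := fun _ => optValue F P)
    (g₂ := fun ω => objective F P (v ω)
      + inner ℝ (gradient (objective F P) (v ω)) (u ω - v ω) + L / 2 * ‖u ω - v ω‖ ^ 2)
    (Filter.Eventually.of_forall fun ω => hf.optValue_le _)
    (Filter.Eventually.of_forall fun ω =>
      le_add_inner_add_sq_of_lipschitz_gradient hf.hasGradientAt (hf.lipschitz_objective hn) _ _)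
    (integrable_const _) ?_
  exact (h.add (integrable_inner_of_memLp hgrad huv)).add
    ((huv.integrable_norm_pow two_ne_zero).const_mul _)

/-- The square integrability of the quantities along the trajectory. -/
theorem memLp_trajectory (hn : 1 ≤ n) (hW : FiniteTimeConsensus τ W) (hF : WellPosed F P)
    (hf : Smooth F P L) (hS : Sampling μ P x₀ ξ) (hI : InitialDataBound μ F P L B x₀)
    (hN : GradientNoise μ F P σ (params F τ W α x₀ ξ) ξ) (k : ℕ) :
    Integrable (fun ω => objective F P (avg (params F τ W α x₀ ξ k ω))) μ ∧
    MemLp (fun ω => gradient (objective F P) (avg (params F τ W α x₀ ξ k ω))) 2 μ ∧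
    MemLp (fun ω => avgGrad F P (params F τ W α x₀ ξ k ω)) 2 μ ∧
    (∀ i, MemLp (fun ω => params F τ W α x₀ ξ k ω i - avg (params F τ W α x₀ ξ k ω)) 2 μ) ∧
    MemLp (fun ω => avg fun i => noise F P (params F τ W α x₀ ξ) ξ k ω i) 2 μ := by
  have hX := hS.measurable_params (τ := τ) (W := W) (α := α) hF k
  have hx := (memLp_iter hn hW hF hf hS hI hN k).1
  have hav := measurable_avg hS.measurable_init
  have hdiff : MemLp (fun ω => avg (params F τ W α x₀ ξ k ω) - avg (x₀ ω)) 2 μ := by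
    refine (memLp_avg hx).ae_eq (Filter.Eventually.of_forall fun ω => ?_)
    simp only [avg_sub, avg_const hn]
  have hobj := hf.integrable_objective_of_memLp_sub hn (measurable_avg hX) hav hI.integrable_obj
    hdiff
  refine ⟨hobj, hf.memLp_gradient_objective hn (measurable_avg hX) hobj, ?_, fun i => ?_, ?_⟩
  · have hH := memLp_localGrads hn hf hI hS.measurable_init hX hx
    exact memLp_avg (memLp_stack_apply (hf.measurable_localGrads hX) hH)
  · refine ((hx i).sub hdiff).ae_eq (Filter.Eventually.of_forall fun ω => ?_)
    simp
  · exact memLp_avg fun i => hN.memLp_noise_apply hF hf (hS.measurable_params hF) hS.measurable k i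

omit [MeasurableSpace Ω] in
theorem measurable_otherSamples_avgGrad (hF : WellPosed F P) (hf : Smooth F P L) (k : ℕ)
    (i : Fin n) :
    Measurable[otherSamples x₀ ξ k i] fun ω => avgGrad F P (params F τ W α x₀ ξ k ω) :=
  hf.measurable_avgGrad (measurable_otherSamples_params hF le_rfl i)

theorem integral_objective_succ_le (hn : 1 ≤ n) (hW : FiniteTimeConsensus τ W)
    (hF : WellPosed F P) (hf : Smooth F P L) (hS : Sampling μ P x₀ ξ)
    (hI : InitialDataBound μ F P L B x₀)
    (hN : GradientNoise μ F P σ (params F τ W α x₀ ξ) ξ) (hα : 0 ≤ α) (k : ℕ) :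
    ∫ ω, objective F P (avg (params F τ W α x₀ ξ (k + 1) ω)) ∂μ
      ≤ ∫ ω, objective F P (avg (params F τ W α x₀ ξ k ω)) ∂μ
        - α / 2 * ∫ ω, ‖gradient (objective F P) (avg (params F τ W α x₀ ξ k ω))‖ ^ 2 ∂μ
        - α / 2 * (1 - L * α) * ∫ ω, ‖avgGrad F P (params F τ W α x₀ ξ k ω)‖ ^ 2 ∂μ
        + α / 2 * (L ^ 2 * (1 / n *
          ∫ ω, ‖deviation n d (WithLp.toLp 2 (params F τ W α x₀ ξ k ω))‖ ^ 2 ∂μ))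
        + L * α ^ 2 / 2 * (σ ^ 2 / n) := by
  obtain ⟨hobj, hgrad, havg, hdev, hnoise⟩ := memLp_trajectory hn hW hF hf hS hI hN k
  have hobj' := (memLp_trajectory hn hW hF hf hS hI hN (k + 1)).1
  have hXm := fun i => measurable_otherSamples_params (F := F) (P := P) (W := W) (α := α)
    (τ := τ) (x₀ := x₀) (ξ := ξ) hF (le_refl k) i
  have hi1 := hgrad.integrable_norm_pow two_ne_zero
  have hi2 := havg.integrable_norm_pow two_ne_zero
  have hi3 : Integrable (fun ω =>
      ∑ i, ‖params F τ W α x₀ ξ k ω i - avg (params F τ W α x₀ ξ k ω)‖ ^ 2) μ :=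
    integrable_finsetSum _ fun i _ => (hdev i).integrable_norm_pow two_ne_zero
  have hi4 := hnoise.integrable_norm_pow two_ne_zero
  have hi5 := integrable_inner_of_memLp havg hnoise
  have hi6 := integrable_inner_of_memLp hgrad hnoise
  have h5 := integral_inner_avg_noise_eq_zero hF hf hS hN k
    (fun i => measurable_otherSamples_avgGrad hF hf k i) havg
  have h6 := integral_inner_avg_noise_eq_zero hF hf hS hN k
    (u := fun ω => gradient (objective F P) (avg (params F τ W α x₀ ξ k ω)))
    (fun i => hf.continuous_gradient_objective.measurable.comp (measurable_avg (hXm i))) hgrad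
  have h4 := integral_norm_avg_noise_sq_le hn hF hf hS hN k
  have hstep := fun ω => hf.objective_step_le hn hα (params F τ W α x₀ ξ k ω)
    (avg fun i => noise F P (params F τ W α x₀ ξ) ξ k ω i)
  simp_rw [← avg_params_succ hn hW] at hstep
  have hmono := integral_mono hobj' (((((hobj.sub (hi1.const_mul (α / 2))).sub
    (hi2.const_mul (α / 2 * (1 - L * α)))).add
    (((hi3.const_mul (1 / (n : ℝ))).const_mul (L ^ 2)).const_mul (α / 2))).add
    (hi4.const_mul (L * α ^ 2 / 2))).add
    ((hi5.const_mul (L * α ^ 2)).sub (hi6.const_mul α))) hstep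
  rw [integral_add', integral_add', integral_add', integral_sub', integral_sub', integral_sub',
    integral_const_mul, integral_const_mul, integral_const_mul, integral_const_mul,
    integral_const_mul, integral_const_mul, integral_const_mul, integral_const_mul, h5, h6] at hmono
  · refine hmono.trans ?_
    simp only [norm_stack_sq, deviation_apply]
    have : L * α ^ 2 / 2 * ∫ ω, ‖avg fun i => noise F P (params F τ W α x₀ ξ) ξ k ω i‖ ^ 2 ∂μ
        ≤ L * α ^ 2 / 2 * (σ ^ 2 / n) :=
      mul_le_mul_of_nonneg_left h4 (by have := hf.pos; positivity)
    linarith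
  all_goals fun_prop

theorem sum_integral_deviation_sq_le (hn : 1 ≤ n) (hW : FiniteTimeConsensus τ W)
    (hF : WellPosed F P) (hf : Smooth F P L) (hS : Sampling μ P x₀ ξ)
    (hI : InitialDataBound μ F P L B x₀)
    (hN : GradientNoise μ F P σ (params F τ W α x₀ ξ) ξ)
    (hα : 48 * α ^ 2 * (τ : ℝ) ^ 4 * L ^ 2 ≤ 1) (T : ℕ) :
    ∑ k ∈ Finset.range (T + 1),
        1 / (n : ℝ) * ∫ ω, ‖deviation n d (WithLp.toLp 2 (params F τ W α x₀ ξ k ω))‖ ^ 2 ∂μ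
      ≤ 25 * τ * B + 384 * α ^ 2 * (τ : ℝ) ^ 3 * σ ^ 2 * (T + 1)
        + α ^ 2 / 2 * (∑ k ∈ Finset.range (T + 1),
            (∫ ω, ‖avgGrad F P (params F τ W α x₀ ξ k ω)‖ ^ 2 ∂μ) + (T + 1) * (σ ^ 2 / n)) := by
  have hn' : (0 : ℝ) < n := by exact_mod_cast hn
  have hτ : (1 : ℝ) ≤ τ := by exact_mod_cast hW.one_le
  have hB := hI.nonneg
  have hX := hS.measurable_params (τ := τ) (W := W) (α := α) hF
  have htraj := memLp_trajectory hn hW hF hf hS hI hN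
  have hD : ∀ k, MemLp (fun ω => deviation n d (WithLp.toLp 2 (params F τ W α x₀ ξ k ω))) 2 μ :=
    fun k => memLp_stack ((measurable_linearMap _).comp ((WithLp.measurable_toLp 2 _).comp (hX k)))
      (by simpa only [deviation_apply] using (htraj k).2.2.2.1)
  have hD0 : MemLp (fun ω => deviation n d (WithLp.toLp 2 (x₀ ω))) 2 μ := hD 0
  have hH0 : MemLp (fun ω => deviation n d (localGrads F P (x₀ ω))) 2 μ :=
    memLp_linearMap _ (memLp_localGrads hn hf hI hS.measurable_init hS.measurable_init
      (hI.memLp_deviation hS.measurable_init))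
  have hG : ∀ k, MemLp (fun ω => ∑ p ∈ Finset.range k,
      noiseGain (cyclicMixing d τ W) (deviation n d) k p
        (noise F P (params F τ W α x₀ ξ) ξ p ω)) 2 μ := fun k =>
    memLp_finsetSum _ fun p _ => memLp_linearMap _ (hN.memLp_noise hF hf hX hS.measurable p)
  have hJ : ∀ k, MemLp (fun ω => avgGrad F P (params F τ W α x₀ ξ k ω)
      + avg fun i => noise F P (params F τ W α x₀ ξ) ξ k ω i) 2 μ := fun k =>
    (htraj k).2.2.1.add (htraj k).2.2.2.2
  have bD0 : ∫ ω, ‖deviation n d (WithLp.toLp 2 (x₀ ω))‖ ^ 2 ∂μ ≤ n * B := by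
    have h := hI.consensus
    simp only [norm_stack_sq, deviation_apply]
    rw [integral_finsetSum _ fun i _ => hI.integrable_consensus i]
    rwa [one_div, inv_mul_le_iff₀ hn'] at h
  have bH0 : ∫ ω, ‖deviation n d (localGrads F P (x₀ ω))‖ ^ 2 ∂μ ≤ n * (B * L ^ 2) := by
    have h := hI.heterogeneity
    simp only [norm_stack_sq, deviation_apply]
    refine (le_of_eq (integral_finsetSum _ fun i _ => hI.integrable_heterogeneity i)).trans ?_
    rwa [one_div, inv_mul_le_iff₀ hn'] at h
  have bG := integral_norm_sum_noiseGain_sq_le hn hW hF hf hS hN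
  have bJ : ∀ k, ∫ ω, ‖avgGrad F P (params F τ W α x₀ ξ k ω)
      + avg fun i => noise F P (params F τ W α x₀ ξ) ξ k ω i‖ ^ 2 ∂μ
      ≤ (∫ ω, ‖avgGrad F P (params F τ W α x₀ ξ k ω)‖ ^ 2 ∂μ) + σ ^ 2 / n := by
    intro k
    obtain ⟨-, -, havg, -, hnoise⟩ := htraj k
    have h0 := integral_inner_avg_noise_eq_zero hF hf hS hN k
      (fun i => measurable_otherSamples_avgGrad hF hf k i) havg
    rw [integral_norm_add_sq havg hnoise, h0, mul_zero, add_zero]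
    gcongr
    exact integral_norm_avg_noise_sq_le hn hF hf hS hN k
  have hmono := integral_mono
    (integrable_finsetSum _ fun k _ => (hD k).integrable_norm_pow two_ne_zero)
    ((((((hD0.integrable_norm_pow two_ne_zero).add
      ((hH0.integrable_norm_pow two_ne_zero).const_mul (α ^ 2 * (τ : ℝ) ^ 2))).const_mul
        (24 * (τ : ℝ))).add
      ((integrable_finsetSum (Finset.range (T + 1)) fun k _ =>
        (hG k).integrable_norm_pow two_ne_zero).const_mul (12 * α ^ 2)))).add
      ((integrable_finsetSum (Finset.range (T + 1)) fun k _ =>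
        ((hJ k).integrable_norm_pow two_ne_zero).const_mul (n : ℝ)).const_mul (α ^ 2 / 2)))
    (sum_deviation_params_sq_le (x₀ := x₀) (ξ := ξ) hn hW hf hα T)
  rw [integral_finsetSum _ fun k _ => (hD k).integrable_norm_pow two_ne_zero, integral_add',
    integral_add', integral_const_mul, integral_add', integral_const_mul, integral_const_mul,
    integral_finsetSum _ fun k _ => (hG k).integrable_norm_pow two_ne_zero, integral_const_mul,
    integral_finsetSum _ fun k _ => ((hJ k).integrable_norm_pow two_ne_zero).const_mul (n : ℝ)]
    at hmono
  rotate_left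
  · exact hD0.integrable_norm_pow two_ne_zero
  · exact (hH0.integrable_norm_pow two_ne_zero).const_mul _
  · exact ((hD0.integrable_norm_pow two_ne_zero).add
      ((hH0.integrable_norm_pow two_ne_zero).const_mul _)).const_mul _
  · exact (integrable_finsetSum (Finset.range (T + 1)) fun k _ =>
      (hG k).integrable_norm_pow two_ne_zero).const_mul _
  · exact (((hD0.integrable_norm_pow two_ne_zero).add
      ((hH0.integrable_norm_pow two_ne_zero).const_mul _)).const_mul _).add
      ((integrable_finsetSum (Finset.range (T + 1)) fun k _ =>
        (hG k).integrable_norm_pow two_ne_zero).const_mul _)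
  · exact (integrable_finsetSum (Finset.range (T + 1)) fun k _ =>
        ((hJ k).integrable_norm_pow two_ne_zero).const_mul (n : ℝ)).const_mul _
  have sG := Finset.sum_le_sum fun k (_ : k ∈ Finset.range (T + 1)) => bG k
  rw [Finset.sum_const, Finset.card_range, nsmul_eq_mul] at sG
  have sJ := Finset.sum_le_sum fun k (_ : k ∈ Finset.range (T + 1)) =>
    mul_le_mul_of_nonneg_left (bJ k) hn'.le
  simp_rw [integral_const_mul] at hmono
  rw [← Finset.mul_sum] at sJ
  rw [← Finset.mul_sum, Finset.sum_add_distrib, Finset.sum_const, Finset.card_range,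
    nsmul_eq_mul] at sJ
  -- This folds the heterogeneity into the consensus term: `24 (1 + 1/48) ≤ 25`.
  have hsmall : α ^ 2 * (τ : ℝ) ^ 2 * L ^ 2 ≤ 1 / 48 := by
    have h1 : (τ : ℝ) ^ 2 ≤ (τ : ℝ) ^ 4 := pow_le_pow_right₀ hτ (by norm_num)
    have h2 : α ^ 2 * (τ : ℝ) ^ 2 * L ^ 2 ≤ α ^ 2 * (τ : ℝ) ^ 4 * L ^ 2 := by gcongr
    linarith
  rw [← Finset.mul_sum, one_div, inv_mul_le_iff₀ hn']
  refine hmono.trans ?_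
  rw [← Finset.mul_sum]
  have hinit : 24 * (τ : ℝ) * (∫ ω, ‖deviation n d (WithLp.toLp 2 (x₀ ω))‖ ^ 2 ∂μ
      + α ^ 2 * (τ : ℝ) ^ 2 * ∫ ω, ‖deviation n d (localGrads F P (x₀ ω))‖ ^ 2 ∂μ)
      ≤ n * (25 * τ * B) := by
    calc _ ≤ 24 * (τ : ℝ) * (n * B + α ^ 2 * (τ : ℝ) ^ 2 * (n * (B * L ^ 2))) := by gcongr
      _ = 24 * (τ : ℝ) * (n * B) * (1 + α ^ 2 * (τ : ℝ) ^ 2 * L ^ 2) := by ring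
      _ ≤ 24 * (τ : ℝ) * (n * B) * (1 + 1 / 48) := by gcongr
      _ ≤ 24 * (τ : ℝ) * (n * B) * (25 / 24) := by gcongr; norm_num
      _ = _ := by ring
  have h2 := mul_le_mul_of_nonneg_left sG (by positivity : 0 ≤ 12 * α ^ 2)
  have h3 := mul_le_mul_of_nonneg_left sJ (by positivity : 0 ≤ α ^ 2 / 2)
  push_cast at h2 h3
  refine (add_le_add (add_le_add hinit h2) h3).trans (le_of_eq ?_)
  ring

/-- The convergence bound for an arbitrary admissible stepsize. -/
theorem sum_integral_gradient_sq_le (hn : 1 ≤ n) (hW : FiniteTimeConsensus τ W)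
    (hF : WellPosed F P) (hf : Smooth F P L) (hS : Sampling μ P x₀ ξ)
    (hI : InitialDataBound μ F P L B x₀)
    (hN : GradientNoise μ F P σ (params F τ W α x₀ ξ) ξ) (hα0 : 0 < α) (hαL : L * α ≤ 1 / 2)
    (hα : 48 * α ^ 2 * (τ : ℝ) ^ 4 * L ^ 2 ≤ 1) (T : ℕ) :
    ∑ k ∈ Finset.range (T + 1), ((∫ ω, ‖avgGrad F P (params F τ W α x₀ ξ k ω)‖ ^ 2 ∂μ)
        + ∫ ω, ‖gradient (objective F P) (avg (params F τ W α x₀ ξ k ω))‖ ^ 2 ∂μ)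
      ≤ 6 * B / α + 67 * τ * L ^ 2 * B + 1024 * L ^ 2 * α ^ 2 * (τ : ℝ) ^ 3 * σ ^ 2 * (T + 1)
        + 4 * L * α * (σ ^ 2 / n) * (T + 1) := by
  have hL := hf.pos
  set A : ℕ → ℝ := fun k =>
    ∫ ω, ‖gradient (objective F P) (avg (params F τ W α x₀ ξ k ω))‖ ^ 2 ∂μ with hA
  set G : ℕ → ℝ := fun k => ∫ ω, ‖avgGrad F P (params F τ W α x₀ ξ k ω)‖ ^ 2 ∂μ with hG
  set C : ℕ → ℝ := fun k => 1 / (n : ℝ) *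
    ∫ ω, ‖deviation n d (WithLp.toLp 2 (params F τ W α x₀ ξ k ω))‖ ^ 2 ∂μ with hC
  set f : ℕ → ℝ := fun k => ∫ ω, objective F P (avg (params F τ W α x₀ ξ k ω)) ∂μ with hfk
  have hG0 : ∀ k, 0 ≤ G k := fun k => integral_nonneg fun _ => sq_nonneg _
  have hdesc : ∀ k, f (k + 1) ≤ f k - α / 2 * A k - α / 4 * G k + α / 2 * L ^ 2 * C k
      + L * α ^ 2 / 2 * (σ ^ 2 / n) := by
    intro k
    have h := integral_objective_succ_le hn hW hF hf hS hI hN hα0.le k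
    have h1 : α / 2 * (1 / 2) * G k ≤ α / 2 * (1 - L * α) * G k := by
      have := hG0 k
      gcongr
      linarith
    linarith
  have htel : ∀ m : ℕ, f m ≤ f 0 - α / 2 * ∑ k ∈ Finset.range m, A k
      - α / 4 * ∑ k ∈ Finset.range m, G k + α / 2 * L ^ 2 * ∑ k ∈ Finset.range m, C k
      + m * (L * α ^ 2 / 2 * (σ ^ 2 / n)) := by
    intro m
    induction m with
    | zero => simp
    | succ m ih =>
      simp only [Finset.sum_range_succ]
      push_cast
      linarith [hdesc m]
  have hlow : optValue F P ≤ f (T + 1) := by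
    have h := integral_mono (integrable_const (optValue F P))
      (memLp_trajectory hn hW hF hf hS hI hN (T + 1)).1 fun ω => hf.optValue_le _
    simpa using h
  have hup : f 0 - optValue F P ≤ B := hI.suboptimality
  have hdev := sum_integral_deviation_sq_le hn hW hF hf hS hI hN hα T
  have hT := htel (T + 1)
  push_cast at hT
  rw [Finset.sum_add_distrib]
  set SA := ∑ k ∈ Finset.range (T + 1), A k with hSA
  set SG := ∑ k ∈ Finset.range (T + 1), G k with hSG
  set SC := ∑ k ∈ Finset.range (T + 1), C k with hSC
  change SC ≤ _ at hdev
  change SG + SA ≤ _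
  have hSG0 : 0 ≤ SG := Finset.sum_nonneg fun k _ => hG0 k
  have hSA0 : 0 ≤ SA := Finset.sum_nonneg fun k _ => integral_nonneg fun _ => sq_nonneg _
  have hB := hI.nonneg
  have hlin : 2 * SA + SG ≤ 4 * (B / α) + 2 * L ^ 2 * SC
      + 2 * (L * α * (σ ^ 2 / n) * (T + 1)) := by
    have h1 : α / 4 * (2 * SA + SG) ≤ α / 4 * (4 * (B / α) + 2 * L ^ 2 * SC
        + 2 * (L * α * (σ ^ 2 / n) * (T + 1))) := by
      have h2 : α / 4 * (4 * (B / α)) = B := by field_simp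
      rw [mul_add (α / 4), mul_add (α / 4), mul_add (α / 4), h2]
      linarith
    exact le_of_mul_le_mul_left h1 (by positivity)
  have hq0 : 0 ≤ σ ^ 2 / n := by positivity
  have hLα : 0 ≤ L * α := by positivity
  have hdev2 := mul_le_mul_of_nonneg_left hdev (by positivity : 0 ≤ 2 * L ^ 2)
  have hz : 0 ≤ (T + 1) * (σ ^ 2 / (n : ℝ)) := by positivity
  -- Absorbing this leaves `2 SA + (3/4) SG` on the left. Multiplying by 4/3 turns 4, 50, 768 and
  -- 5/2 into at most 6, 67, 1024 and 4.
  have h5 : (L * α) ^ 2 * SG ≤ 1 / 4 * SG := by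
    gcongr
    nlinarith
  have h6 : (L * α) ^ 2 * ((T + 1) * (σ ^ 2 / (n : ℝ)))
      ≤ 1 / 2 * (L * α) * ((T + 1) * (σ ^ 2 / (n : ℝ))) := by
    gcongr
    nlinarith
  have h7 : 0 ≤ B / α := by positivity
  have h8 : 0 ≤ (τ : ℝ) * L ^ 2 * B := by positivity
  have h9 : 0 ≤ L ^ 2 * α ^ 2 * (τ : ℝ) ^ 3 * σ ^ 2 * (T + 1) := by positivity
  have h10 : 0 ≤ (L * α) * ((T + 1) * (σ ^ 2 / (n : ℝ))) := by positivity
  have e1 : 6 * B / α = 6 * (B / α) := by ring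
  rw [e1]
  have e2 : 2 * L ^ 2 * (25 * τ * B + 384 * α ^ 2 * (τ : ℝ) ^ 3 * σ ^ 2 * (T + 1)
      + α ^ 2 / 2 * (SG + (T + 1) * (σ ^ 2 / n)))
      = 50 * ((τ : ℝ) * L ^ 2 * B) + 768 * (L ^ 2 * α ^ 2 * (τ : ℝ) ^ 3 * σ ^ 2 * (T + 1))
        + (L * α) ^ 2 * SG + (L * α) ^ 2 * ((T + 1) * (σ ^ 2 / n)) := by ring
  rw [e2] at hdev2
  linarith

end Expectation

/-! ### Tuning the stepsize -/

section Stepsize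

variable {n τ T : ℕ} {L σ : ℝ}

/-- This stepsize equates the error `c₁ a` with `c₀ / (a t)`. -/
theorem rpow_half_balance {c₀ c₁ t : ℝ} (h₀ : 0 < c₀) (h₁ : 0 < c₁) (ht : 0 < t) :
    c₁ * (c₀ / (c₁ * t)) ^ (1 / 2 : ℝ) = (c₀ * c₁ / t) ^ (1 / 2 : ℝ) ∧
      c₀ / ((c₀ / (c₁ * t)) ^ (1 / 2 : ℝ) * t) = (c₀ * c₁ / t) ^ (1 / 2 : ℝ) := by
  simp only [← Real.sqrt_eq_rpow]
  have h1 : c₁ * √(c₀ / (c₁ * t)) = √(c₀ * c₁ / t) := by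
    rw [eq_comm, Real.sqrt_eq_iff_mul_self_eq (by positivity) (by positivity), mul_mul_mul_comm,
      Real.mul_self_sqrt (by positivity)]
    field_simp
  refine ⟨h1, ?_⟩
  rw [← h1, div_eq_iff (by positivity)]
  calc c₀ = c₁ * (c₀ / (c₁ * t)) * t := by field_simp
    _ = c₁ * (√(c₀ / (c₁ * t)) * √(c₀ / (c₁ * t))) * t := by
      rw [Real.mul_self_sqrt (by positivity)]
    _ = _ := by ring

/-- The same balance for `c₂ a²`. The common value is specified by its cube, which avoids expanding
fractional powers of a product. -/
theorem rpow_third_balance {c₀ c₂ t : ℝ} (h₀ : 0 < c₀) (h₂ : 0 < c₂) (ht : 0 < t) {q : ℝ}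
    (hq : 0 ≤ q) (hq3 : q ^ 3 = c₂ * c₀ ^ 2 / t ^ 2) :
    c₂ * ((c₀ / (c₂ * t)) ^ (1 / 3 : ℝ)) ^ 2 = q ∧
      c₀ / ((c₀ / (c₂ * t)) ^ (1 / 3 : ℝ) * t) = q := by
  set a := (c₀ / (c₂ * t)) ^ (1 / 3 : ℝ) with ha
  have ha0 : 0 < a := by positivity
  have ha3 : a ^ 3 = c₀ / (c₂ * t) := by
    rw [ha, ← Real.rpow_natCast, ← Real.rpow_mul (by positivity)]
    norm_num
  have h1 : c₂ * a ^ 2 = q := by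
    refine (pow_left_inj₀ (by positivity) hq three_ne_zero).1 ?_
    calc (c₂ * a ^ 2) ^ 3 = c₂ ^ 3 * (a ^ 3) ^ 2 := by ring
      _ = _ := by rw [ha3, hq3]; field_simp
  refine ⟨h1, ?_⟩
  rw [← h1, div_eq_iff (by positivity)]
  calc c₀ = c₂ * (c₀ / (c₂ * t)) * t := by field_simp
    _ = _ := by rw [← ha3]; ring

theorem rate_cube (hσ : 0 < σ) :
    ((τ : ℝ) * L ^ 2 * σ ^ (2 / 3 : ℝ) / (T : ℝ) ^ (2 / 3 : ℝ)) ^ 3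
      = (τ : ℝ) ^ 3 * L ^ 2 * σ ^ 2 * (L ^ 2) ^ 2 / (T : ℝ) ^ 2 := by
  have h : ∀ x : ℝ, 0 ≤ x → (x ^ (2 / 3 : ℝ)) ^ 3 = x ^ 2 := by
    intro x hx
    rw [← Real.rpow_natCast, ← Real.rpow_mul hx]
    norm_num
  rw [div_pow, mul_pow, h _ hσ.le, h _ (Nat.cast_nonneg T)]
  ring

/-- The properties of the tuned stepsize that enter the convergence rate. -/
theorem tunedStep_spec (hn : 1 ≤ n) (hτ : 1 ≤ τ) (hT : 1 ≤ T) (hL : 0 < L) (hσ : 0 < σ) :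
    0 < tunedStep n τ L σ T ∧ L * tunedStep n τ L σ T ≤ 1 / 2 ∧
    48 * tunedStep n τ L σ T ^ 2 * (τ : ℝ) ^ 4 * L ^ 2 ≤ 1 ∧
    L * tunedStep n τ L σ T * (σ ^ 2 / n) ≤ (L ^ 3 * σ ^ 2 / (n * T)) ^ (1 / 2 : ℝ) ∧
    L ^ 2 * tunedStep n τ L σ T ^ 2 * (τ : ℝ) ^ 3 * σ ^ 2
      ≤ τ * L ^ 2 * σ ^ (2 / 3 : ℝ) / (T : ℝ) ^ (2 / 3 : ℝ) ∧
    L ^ 2 / (tunedStep n τ L σ T * T) ≤ (L ^ 3 * σ ^ 2 / (n * T)) ^ (1 / 2 : ℝ)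
      + τ * L ^ 2 * σ ^ (2 / 3 : ℝ) / (T : ℝ) ^ (2 / 3 : ℝ) + 7 * (τ : ℝ) ^ 2 * L ^ 3 / T := by
  have hn' : (0 : ℝ) < n := by exact_mod_cast hn
  have hT' : (0 : ℝ) < T := by exact_mod_cast hT
  have hτ' : (1 : ℝ) ≤ τ := by exact_mod_cast hτ
  have hτ0 : (0 : ℝ) < τ := by linarith
  have hs0 : 0 < √3 := by positivity
  have hs3 : √3 ^ 2 = 3 := Real.sq_sqrt (by norm_num)
  obtain ⟨p1, p2⟩ := rpow_half_balance (c₀ := L ^ 2) (c₁ := L * σ ^ 2 / n) (t := T)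
    (by positivity) (by positivity) hT'
  obtain ⟨q1, q2⟩ := rpow_third_balance (c₀ := L ^ 2) (c₂ := (τ : ℝ) ^ 3 * L ^ 2 * σ ^ 2) (t := T)
    (by positivity) (by positivity) hT' (by positivity) (rate_cube (τ := τ) (L := L) hσ)
  have hR : L ^ 2 * (L * σ ^ 2 / n) / T = L ^ 3 * σ ^ 2 / (n * T) := by field_simp
  rw [hR] at p1 p2
  set R := (L ^ 3 * σ ^ 2 / (n * T)) ^ (1 / 2 : ℝ)
  set q := τ * L ^ 2 * σ ^ (2 / 3 : ℝ) / (T : ℝ) ^ (2 / 3 : ℝ)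
  have hR0 : 0 ≤ R := by positivity
  have hq0 : 0 ≤ q := by positivity
  set a₁ := (L ^ 2 / (L * σ ^ 2 / n * T)) ^ (1 / 2 : ℝ) with ha₁
  set a₂ := (L ^ 2 / ((τ : ℝ) ^ 3 * L ^ 2 * σ ^ 2 * T)) ^ (1 / 3 : ℝ) with ha₂
  set a₃ := 1 / (2 * L) with ha₃
  set a₄ := 1 / (4 * √3 * (τ : ℝ) ^ 2 * L) with ha₄
  have hα : tunedStep n τ L σ T = min (min a₁ a₂) (min a₃ a₄) := rfl
  have h1 : 0 < a₁ := by positivity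
  have h2 : 0 < a₂ := by positivity
  have h3 : 0 < a₃ := by positivity
  have h4 : 0 < a₄ := by positivity
  rw [hα]
  set α := min (min a₁ a₂) (min a₃ a₄) with hα'
  have hα0 : 0 < α := lt_min (lt_min h1 h2) (lt_min h3 h4)
  have hα1 : α ≤ a₁ := (min_le_left _ _).trans (min_le_left _ _)
  have hα2 : α ≤ a₂ := (min_le_left _ _).trans (min_le_right _ _)
  have hα3 : α ≤ a₃ := (min_le_right _ _).trans (min_le_left _ _)
  have hα4 : α ≤ a₄ := (min_le_right _ _).trans (min_le_right _ _)
  have hsum0 : 0 ≤ 7 * (τ : ℝ) ^ 2 * L ^ 3 / T := by positivity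
  refine ⟨hα0, ?_, ?_, ?_, ?_, ?_⟩
  · calc L * α ≤ L * a₃ := by gcongr
      _ = 1 / 2 := by rw [ha₃]; field_simp
  · calc 48 * α ^ 2 * (τ : ℝ) ^ 4 * L ^ 2 ≤ 48 * a₄ ^ 2 * (τ : ℝ) ^ 4 * L ^ 2 := by gcongr
      _ = 48 / (16 * √3 ^ 2) := by rw [ha₄]; field_simp; norm_num
      _ ≤ 1 := by rw [hs3]; norm_num
  · calc L * α * (σ ^ 2 / n) = L * σ ^ 2 / n * α := by ring
      _ ≤ L * σ ^ 2 / n * a₁ := by gcongr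
      _ = R := p1
  · calc L ^ 2 * α ^ 2 * (τ : ℝ) ^ 3 * σ ^ 2 = (τ : ℝ) ^ 3 * L ^ 2 * σ ^ 2 * α ^ 2 := by ring
      _ ≤ (τ : ℝ) ^ 3 * L ^ 2 * σ ^ 2 * a₂ ^ 2 := by gcongr
      _ = q := q1
  -- The minimum is one of its four entries, so the reciprocal is bounded by the sum of the four
  -- reciprocal terms; the last two fit in the `7 τ²` term since `4√3 ≤ 7`.
  · have hcase : α = a₁ ∨ α = a₂ ∨ α = a₃ ∨ α = a₄ := by
      rcases min_choice (min a₁ a₂) (min a₃ a₄) with h | h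
      · rcases min_choice a₁ a₂ with h' | h'
        · exact Or.inl (h.trans h')
        · exact Or.inr (Or.inl (h.trans h'))
      · rcases min_choice a₃ a₄ with h' | h'
        · exact Or.inr (Or.inr (Or.inl (h.trans h')))
        · exact Or.inr (Or.inr (Or.inr (h.trans h')))
    rcases hcase with h | h | h | h <;> rw [h]
    · linarith
    · linarith
    · have e : L ^ 2 / (a₃ * T) = 2 * 1 * L ^ 3 / T := by rw [ha₃]; field_simp
      have : 2 * 1 * L ^ 3 / (T : ℝ) ≤ 7 * (τ : ℝ) ^ 2 * L ^ 3 / T := by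
        gcongr
        · norm_num
        · nlinarith
      linarith
    · have e : L ^ 2 / (a₄ * T) = 4 * √3 * (τ : ℝ) ^ 2 * L ^ 3 / T := by rw [ha₄]; field_simp
      have : 4 * √3 * (τ : ℝ) ^ 2 * L ^ 3 / (T : ℝ) ≤ 7 * (τ : ℝ) ^ 2 * L ^ 3 / T := by
        gcongr
        nlinarith
      linarith

end Stepsize

end GTFT

/-! ### The convergence rate with the tuned stepsize -/

theorem mainTheorem3 (ℓ B : ℝ) (hℓ : 0 < ℓ) :
    ∃ γ₄ γ₅ γ₆ : ℝ, 0 < γ₄ ∧ 0 < γ₅ ∧ 0 < γ₆ ∧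
      ∀ (n d τ : ℕ) (_ : 1 ≤ n)
        (Ξ : Fin n → Type*) [∀ i, MeasurableSpace (Ξ i)]
        (P : ∀ i, Measure (Ξ i)) [∀ i, IsProbabilityMeasure (P i)]
        (F : ∀ i, GTFT.Vec d → Ξ i → ℝ)
        (W : ℕ → Matrix (Fin n) (Fin n) ℝ)
        (Ω : Type*) [MeasurableSpace Ω] (μ : Measure Ω) [IsProbabilityMeasure μ]
        (x₀ : Ω → Fin n → GTFT.Vec d) (ξ : ℕ → ∀ i, Ω → Ξ i)
        (L σ : ℝ) (T : ℕ) (X : ℕ → Ω → Fin n → GTFT.Vec d),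
        ℓ ≤ L →
        τ ≤ T →
        GTFT.FiniteTimeConsensus τ W →
        GTFT.WellPosed F P →
        GTFT.Smooth F P L →
        GTFT.Sampling μ P x₀ ξ →
        GTFT.InitialDataBound μ F P L B x₀ →
        X = GTFT.params F τ W (GTFT.tunedStep n τ L σ T) x₀ ξ →
        GTFT.GradientNoise μ F P σ X ξ →
        (∀ k ≤ T,
          Integrable (fun ω => ‖GTFT.avgGrad F P (X k ω)‖ ^ 2) μ ∧
          Integrable (fun ω => ‖gradient (GTFT.objective F P) (GTFT.avg (X k ω))‖ ^ 2) μ) ∧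
        (1 / ((T : ℝ) + 1)) * ∑ k ∈ Finset.range (T + 1),
            ((∫ ω, ‖GTFT.avgGrad F P (X k ω)‖ ^ 2 ∂μ) +
              ∫ ω, ‖gradient (GTFT.objective F P) (GTFT.avg (X k ω))‖ ^ 2 ∂μ)
          ≤ γ₄ * (τ : ℝ) ^ 2 * L ^ 3 / T
            + γ₅ * τ * L ^ 2 * σ ^ (2 / 3 : ℝ) / (T : ℝ) ^ (2 / 3 : ℝ)
            + γ₆ * (L ^ 3 * σ ^ 2 / (n * T)) ^ (1 / 2 : ℝ) := by
  -- `42 = 6 · 7` comes from the last term of the bound on `L² / (α T)`. The summand 1 keeps the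
  -- first constant positive for `B = 0`; the absolute values do so for negative `B`, which no
  -- initial data satisfy.
  refine ⟨42 * |B| / ℓ ^ 2 + 67 * |B| / ℓ + 1, 6 * |B| / ℓ ^ 2 + 1024, 6 * |B| / ℓ ^ 2 + 4,
    by positivity, by positivity, by positivity, ?_⟩
  intro n d τ hn Ξ _ P _ F W Ω _ μ _ x₀ ξ L σ T X hL hT hW hF hf hS hI hX hN
  subst hX
  have hτ := hW.one_le
  obtain ⟨hα0, hαL, hα, hR, hq, hinv⟩ := GTFT.tunedStep_spec (σ := σ) hn hτ (hτ.trans hT) hf.pos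
    hN.pos
  refine ⟨fun k _ => ?_, ?_⟩
  · obtain ⟨-, hgrad, havg, -⟩ := GTFT.memLp_trajectory hn hW hF hf hS hI hN k
    exact ⟨havg.integrable_norm_pow two_ne_zero, hgrad.integrable_norm_pow two_ne_zero⟩
  have hmain := GTFT.sum_integral_gradient_sq_le hn hW hF hf hS hI hN hα0 hαL hα T
  have hB := hI.nonneg
  rw [abs_of_nonneg hB]
  set α := GTFT.tunedStep n τ L σ T
  set R := (L ^ 3 * σ ^ 2 / (n * T)) ^ (1 / 2 : ℝ)
  have hq' : (6 * B / ℓ ^ 2 + 1024) * τ * L ^ 2 * σ ^ (2 / 3 : ℝ) / (T : ℝ) ^ (2 / 3 : ℝ)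
      = (6 * B / ℓ ^ 2 + 1024) * (τ * L ^ 2 * σ ^ (2 / 3 : ℝ) / (T : ℝ) ^ (2 / 3 : ℝ)) := by ring
  rw [hq']
  set q := τ * L ^ 2 * σ ^ (2 / 3 : ℝ) / (T : ℝ) ^ (2 / 3 : ℝ)
  have hL0 := hf.pos
  have hT0 : (0 : ℝ) < T := by exact_mod_cast hτ.trans hT
  have hτ' : (1 : ℝ) ≤ τ := by exact_mod_cast hτ
  -- The lower bound `ℓ ≤ L` makes the constants independent of `L`: here through `1 / L² ≤ 1 / ℓ²`,
  -- below through `1 / L ≤ 1 / ℓ` together with `τ ≤ τ²`.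
  have hfirst : 6 * B / α / T ≤ 6 * B / ℓ ^ 2 * (R + q + 7 * (τ : ℝ) ^ 2 * L ^ 3 / T) := by
    calc 6 * B / α / T = 6 * B / L ^ 2 * (L ^ 2 / (α * T)) := by field_simp
      _ ≤ 6 * B / ℓ ^ 2 * (L ^ 2 / (α * T)) := by gcongr
      _ ≤ _ := by gcongr
  have hsecond : 67 * τ * L ^ 2 * B / T ≤ 67 * B / ℓ * ((τ : ℝ) ^ 2 * L ^ 3 / T) := by
    calc 67 * τ * L ^ 2 * B / T = 67 * B / L * ((τ : ℝ) * L ^ 3 / T) := by field_simp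
      _ ≤ 67 * B / ℓ * ((τ : ℝ) ^ 2 * L ^ 3 / T) := by
        gcongr
        nlinarith
  have hnn : 0 ≤ 6 * B / α + 67 * τ * L ^ 2 * B := by positivity
  have hlast : 0 ≤ (τ : ℝ) ^ 2 * L ^ 3 / T := by positivity
  calc _ ≤ 1 / ((T : ℝ) + 1) * (6 * B / α + 67 * τ * L ^ 2 * B
        + 1024 * L ^ 2 * α ^ 2 * (τ : ℝ) ^ 3 * σ ^ 2 * (T + 1)
        + 4 * L * α * (σ ^ 2 / n) * (T + 1)) := by gcongr
    _ = (6 * B / α + 67 * τ * L ^ 2 * B) / (T + 1)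
        + 1024 * (L ^ 2 * α ^ 2 * (τ : ℝ) ^ 3 * σ ^ 2) + 4 * (L * α * (σ ^ 2 / n)) := by
        field_simp
    _ ≤ (6 * B / α + 67 * τ * L ^ 2 * B) / T + 1024 * q + 4 * R := by
        gcongr
        linarith
    _ = 6 * B / α / T + 67 * τ * L ^ 2 * B / T + 1024 * q + 4 * R := by rw [add_div]
    _ ≤ 6 * B / ℓ ^ 2 * (R + q + 7 * (τ : ℝ) ^ 2 * L ^ 3 / T)
        + 67 * B / ℓ * ((τ : ℝ) ^ 2 * L ^ 3 / T) + 1024 * q + 4 * R + (τ : ℝ) ^ 2 * L ^ 3 / T := by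
        linarith
    _ = _ := by ring
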